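/- Fix $\mu_\theta\in\mathbb R$, $\sigma_\theta>0$ and a signal dimension $\bar d$. An LQG game $\mathcal G=(b,c,w,\mathcal P)$ with agents $i\in[0,1]$ consists of the following. (Payoffs.) Agent $i$ has utility $u_i(x,y,\theta)=z^\top U(i)z$, $z=(x,y,\theta,1)^\top$, with $U(i)\in\mathbb R^{4\times4}$ symmetric, $U_{11}(i)<0$, $-U_{12}(i)/U_{11}(i)=1$; put $b(i)=-U_{13}(i)/U_{11}(i)$, $c(i)=-U_{14}(i)/U_{11}(i)$. The functions $b,c:[0,1]\to\mathbb R$ and the weight function $w:[0,1]^2\to\mathbb R$ are measurable and square integrable. (Information.) The state $\theta\sim\mathcal N(\mu_\theta,\sigma_\theta^2)$ and signals $S(i)\in\mathbb R^{\bar d}$, $i\in[0,1]$, form a Gaussian process; with $m(i)=\mathbb E[S(i)]$, $K(i,j)=\mathrm{Cov}(S(i),S(j))$, $K_\theta(i)=\mathrm{Cov}(S(i),\theta)$, the joint covariance matrix of the signals of any finite set of agents is invertible. The information structure is $\mathcal P=(P,P_\theta)$ with $P(i,j)=K(i,i)^{-1/2}K(i,j)K(j,j)^{-1/2}$ and $P_\theta(i)=\sigma_\theta^{-1}K(i,i)^{-1/2}K_\theta(i)$,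 both measurable. A strategy profile is a family of measurable maps $X(i):\mathbb R^{\bar d}\to\mathbb R$ (write $X(i)$ also for the random variable $X(i)[S(i)]$) with $\mathbb E|X(i)|^2<\infty$ such that $i\mapsto\mathbb E[X(i)X(j)]$ is measurable for each $j$ and $i\mapsto\mathbb E|X(i)|^2$ is integrable. It is a Bayesian Nash equilibrium if, for every agent $i$ with $w(i,\cdot)\in L_2[0,1]$ (these are almost all agents), the Pettis integral $Y(i)=\int_0^1 w(i,j)X(j)\,dj$ exists and $X(i)[s]$ maximizes $x\mapsto\mathbb E[u_i(x,Y(i),\theta)\mid S(i)=s]$ over $\mathbb R$ for almost every signal realization $s$ of $S(i)$. An affine equilibrium is $\bar\varphi=(\varphi_0,\varphi)\in L_2([0,1];\mathbb R^{\bar d+1})$ such that $X(i)[s]=\varphi_0(i)+\varphi(i)^\top K(i,i)^{-1/2}(s-m(i))$ is a Bayesian Nash equilibrium; it is unique if every affine equilibrium agrees with it at every agent $i$ with $w(i,\cdot)\in L_2[0,1]$. Games (with the same $\bar d$) are compared by $$\|\mathcal G-\mathcal G'\|=\|b-b'\|+\|c-c'\|+\|w-w'\|+\|P-P'\|+\|P_\theta-P_\theta'\|,$$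 all norms being $L_2$-norms over $[0,1]$ or $[0,1]^2$, where vectors carry the Euclidean norm and matrices the induced operator norm. Theorem 1. (Denseness.) For every LQG game $\mathcal G=(b,c,w,\mathcal P)$ and every $\epsilon>0$ there is a weight function $w'$ with $\|w-w'\|<\epsilon$ such that $\mathcal G'=(b,c,w',\mathcal P)$ (so $\|\mathcal G-\mathcal G'\|<\epsilon$) has a unique affine equilibrium. (Openness.) If $\mathcal G$ has a unique affine equilibrium, there is $\delta>0$ such that every LQG game $\mathcal G'$ with $\|\mathcal G-\mathcal G'\|<\delta$ has a unique affine equilibrium. (Convergence.) If $\mathcal G$ has a unique affine equilibrium $\bar\varphi$ and $\mathcal G_n$ are LQG games with $\|\mathcal G-\mathcal G_n\|\to0$, then $\mathcal G_n$ has a unique affine equilibrium $\bar\varphi_n$ for all large $n$, and $\|\bar\varphi-\bar\varphi_n\|\to0$ in $L_2([0,1];\mathbb R^{\bar d+1})$. -/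

import Mathlib

open MeasureTheory ProbabilityTheory Filter Topology Set
open scoped ENNReal

universe u

noncomputable section

section Root

open scoped MatrixOrder

/-- The inverse square root `A ^ (-1/2)`, i.e. the positive semidefinite root of `A⁻¹`. -/
def invSqrt {d : ℕ} (A : Matrix (Fin d) (Fin d) ℝ) : Matrix (Fin d) (Fin d) ℝ :=
  CFC.sqrt A⁻¹

end Root

/-- A state `θ ~ N(μθ, σθ²)` together with `d`-dimensional signals `S i` of the agents `i ∈ [0,1]`,
such that the state and all signal components form a Gaussian process, and such that the joint
covariance matrix of the signals of any finite set of agents is invertible. -/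
structure SignalProcess (d : ℕ) (μθ σθ : ℝ) where
  Ω : Type u
  mΩ : MeasurableSpace Ω
  Pr : Measure Ω
  isProb : IsProbabilityMeasure Pr
  θ : Ω → ℝ
  S : unitInterval → Ω → Fin d → ℝ
  measurable_θ : Measurable θ
  measurable_S : ∀ i, Measurable (S i)
  θ_law : Pr.map θ = gaussianReal μθ (Real.toNNReal (σθ ^ 2))
  gaussian : IsGaussianProcess
    (fun (t : Option (unitInterval × Fin d)) (ω : Ω) => t.elim (θ ω) fun p => S p.1 ω p.2) Pr
  invertible_cov : ∀ N : Finset unitInterval,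
    IsUnit (Matrix.of fun p q : N × Fin d =>
      cov[fun ω => S p.1 ω p.2, fun ω => S q.1 ω q.2; Pr])

attribute [instance] SignalProcess.mΩ SignalProcess.isProb

namespace SignalProcess

variable {d : ℕ} {μθ σθ : ℝ} (Q : SignalProcess.{u} d μθ σθ)

/-- The mean vector `m i = 𝔼[S i]`. -/
def m (i : unitInterval) : Fin d → ℝ := fun k => ∫ ω, Q.S i ω k ∂Q.Pr

/-- `K i j = Cov(S i, S j)`. -/
def K (i j : unitInterval) : Matrix (Fin d) (Fin d) ℝ :=
  Matrix.of fun k l => cov[fun ω => Q.S i ω k, fun ω => Q.S j ω l; Q.Pr]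

/-- `Kθ i = Cov(S i, θ)`. -/
def Kθ (i : unitInterval) : Fin d → ℝ := fun k => cov[fun ω => Q.S i ω k, Q.θ; Q.Pr]

/-- The standardized covariance `P i j = K(i,i)^(-1/2) K(i,j) K(j,j)^(-1/2)`. -/
def P (i j : unitInterval) : Matrix (Fin d) (Fin d) ℝ :=
  invSqrt (Q.K i i) * Q.K i j * invSqrt (Q.K j j)

/-- The standardized covariance `Pθ i = σθ⁻¹ K(i,i)^(-1/2) Kθ(i)`. -/
def Pθ (i : unitInterval) : Fin d → ℝ := (1 / σθ) • (invSqrt (Q.K i i)).mulVec (Q.Kθ i)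

end SignalProcess

/-- An information structure: a signal process whose standardized covariances
`P : [0,1]² → ℝ^(d×d)` and `Pθ : [0,1] → ℝ^d` are measurable functions. -/
structure InfoStructure (d : ℕ) (μθ σθ : ℝ) extends SignalProcess.{u} d μθ σθ where
  measurable_P : ∀ k l, Measurable fun p : unitInterval × unitInterval =>
    toSignalProcess.P p.1 p.2 k l
  measurable_Pθ : ∀ k, Measurable fun i : unitInterval => toSignalProcess.Pθ i k

/-- An LQG game `(b, c, w, 𝒫)`. Agent `i` has the utility `zᵀ U(i) z` with `z = (x, y, θ, 1)`, where
`U(i)` is symmetric, `U₁₁(i) < 0`, normalized by `-U₁₂(i)/U₁₁(i) = 1`, with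
`b(i) = -U₁₃(i)/U₁₁(i)`, `c(i) = -U₁₄(i)/U₁₁(i)`; the functions `b, c, w` are square integrable. -/
structure LQGGame (d : ℕ) (μθ σθ : ℝ) where
  U : unitInterval → Matrix (Fin 4) (Fin 4) ℝ
  U_symm : ∀ i, (U i).IsSymm
  U_neg : ∀ i, U i 0 0 < 0
  U_normalized : ∀ i, -U i 0 1 / U i 0 0 = 1
  b : unitInterval → ℝ
  c : unitInterval → ℝ
  b_eq : ∀ i, b i = -U i 0 2 / U i 0 0
  c_eq : ∀ i, c i = -U i 0 3 / U i 0 0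
  w : unitInterval → unitInterval → ℝ
  measurable_b : Measurable b
  measurable_c : Measurable c
  measurable_w : Measurable (Function.uncurry w)
  memLp_b : MemLp b 2 volume
  memLp_c : MemLp c 2 volume
  memLp_w : MemLp (Function.uncurry w) 2 volume
  info : InfoStructure.{u} d μθ σθ

/-- `Y` is the Pettis integral over `[0,1]` of the process `f`, viewed as a map
from `[0,1]` to the Hilbert space of square integrable random variables. -/
def IsPettisIntegral {Ω : Type u} [MeasurableSpace Ω] (Pr : Measure Ω)
    (f : unitInterval → Ω → ℝ) (Y : Ω → ℝ) : Prop :=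
  MemLp Y 2 Pr ∧ (∀ j, MemLp (f j) 2 Pr) ∧ ∀ Z : Ω → ℝ, MemLp Z 2 Pr →
    Integrable (fun j => ∫ ω, f j ω * Z ω ∂Pr) volume ∧
      ∫ ω, Y ω * Z ω ∂Pr = ∫ j, ∫ ω, f j ω * Z ω ∂Pr

namespace LQGGame

variable {d : ℕ} {μθ σθ : ℝ} (G : LQGGame.{u} d μθ σθ)

/-- The utility `u_i(x, y, θ)`. -/
def utility (i : unitInterval) (x y t : ℝ) : ℝ :=
  dotProduct ![x, y, t, 1] ((G.U i).mulVec ![x, y, t, 1])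

/-- The random action of agent `i` induced by the profile `X` of maps from signals to actions. -/
def action (X : unitInterval → (Fin d → ℝ) → ℝ) (i : unitInterval) (ω : G.info.Ω) : ℝ :=
  X i (G.info.S i ω)

/-- Strategy profiles: measurable strategies with finite second moments, satisfying the two
regularity conditions across agents. -/
structure IsStrategyProfile (X : unitInterval → (Fin d → ℝ) → ℝ) : Prop where
  measurable : ∀ i, Measurable (X i)
  memLp : ∀ i, MemLp (G.action X i) 2 G.info.Pr
  measurable_moment : ∀ j,
    Measurable fun i => ∫ ω, G.action X i ω * G.action X j ω ∂G.info.Pr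
  integrable_moment : Integrable (fun i => ∫ ω, |G.action X i ω| ^ 2 ∂G.info.Pr) volume

/-- The agents `i` with square integrable weight section `w(i, ·)`, i.e. those whose local aggregate
`∫ w(i,j) X(j) dj` is defined for all strategy profiles. These are almost all agents. -/
def agents : Set unitInterval := {i | MemLp (G.w i) 2 volume}

theorem ae_mem_agents : ∀ᵐ i, i ∈ G.agents := by
  have h : Integrable (fun p : unitInterval × unitInterval => Function.uncurry G.w p ^ 2)
      (volume.prod volume) := G.memLp_w.integrable_sq
  filter_upwards [h.prod_right_ae] with i hi
  have hm : AEStronglyMeasurable (G.w i) volume :=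
    (G.measurable_w.comp measurable_prodMk_left).aestronglyMeasurable
  exact (memLp_two_iff_integrable_sq hm).2 hi

/-- `𝔼[u_i(x, Y, θ) | S i = s]`, through the regular conditional law of `(Y, θ)` given `S i`. -/
def condUtility (i : unitInterval) (Y : G.info.Ω → ℝ) (s : Fin d → ℝ) (x : ℝ) : ℝ :=
  ∫ p, G.utility i x p.1 p.2 ∂(condDistrib (fun ω => (Y ω, G.info.θ ω)) (G.info.S i) G.info.Pr s)

/-- Bayesian Nash equilibrium: each agent's local aggregate exists as a Pettis integral and, for
(almost) every signal realization, her action maximizes her conditional expected utility. -/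
def IsBNE (X : unitInterval → (Fin d → ℝ) → ℝ) : Prop :=
  G.IsStrategyProfile X ∧ ∀ i ∈ G.agents,
    ∃ Y : G.info.Ω → ℝ, IsPettisIntegral G.info.Pr (fun j ω => G.w i j * G.action X j ω) Y ∧
      ∀ᵐ s ∂(G.info.Pr.map (G.info.S i)), IsMaxOn (G.condUtility i Y s) univ (X i s)

/-- The affine strategies with coefficients `(φ₀, φ)`:
`X i s = φ₀ i + (φ i)ᵀ K(i,i)^(-1/2) (s - m i)`. Coordinate `0` of `φ i` is the intercept. -/
def affineProfile (φ : unitInterval → EuclideanSpace ℝ (Fin (d + 1)))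
    (i : unitInterval) (s : Fin d → ℝ) : ℝ :=
  φ i 0 + dotProduct (fun k : Fin d => φ i k.succ)
    ((invSqrt (G.info.K i i)).mulVec (s - G.info.m i))

/-- Affine equilibria: coefficient functions in `L₂([0,1]; ℝ^(d+1))` whose affine strategy
profile is a Bayesian Nash equilibrium. -/
def IsAffineEquilibrium (φ : unitInterval → EuclideanSpace ℝ (Fin (d + 1))) : Prop :=
  Measurable φ ∧ MemLp φ 2 volume ∧ G.IsBNE (G.affineProfile φ)

/-- `φ` is the unique affine equilibrium. -/
def IsUniqueAffineEquilibrium (φ : unitInterval → EuclideanSpace ℝ (Fin (d + 1))) : Prop :=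
  G.IsAffineEquilibrium φ ∧ ∀ ψ, G.IsAffineEquilibrium ψ → ∀ i ∈ G.agents, ψ i = φ i

/-- There is a unique affine equilibrium. -/
def HasUniqueAffineEquilibrium : Prop := ∃ φ, G.IsUniqueAffineEquilibrium φ

/-- `‖w - w'‖` in `L₂([0,1]²)`. -/
def weightDist (w w' : unitInterval → unitInterval → ℝ) : ℝ≥0∞ :=
  eLpNorm (fun p : unitInterval × unitInterval => w p.1 p.2 - w' p.1 p.2) 2 volume

/-- The `L₂` distance of two LQG games:
`‖b - b'‖ + ‖c - c'‖ + ‖w - w'‖ + ‖P - P'‖ + ‖Pθ - Pθ'‖`, where matrices carry the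
operator norm induced by the Euclidean norm. -/
def gameDist (G G' : LQGGame.{u} d μθ σθ) : ℝ≥0∞ :=
  eLpNorm (fun i => G.b i - G'.b i) 2 volume
  + eLpNorm (fun i => G.c i - G'.c i) 2 volume
  + weightDist G.w G'.w
  + eLpNorm (fun p : unitInterval × unitInterval =>
      Matrix.toEuclideanCLM (𝕜 := ℝ) (G.info.P p.1 p.2 - G'.info.P p.1 p.2)) 2 volume
  + eLpNorm (fun i => WithLp.toLp 2 (G.info.Pθ i - G'.info.Pθ i)) 2 volume

end LQGGame

end

/-!
Conditioning on Gaussian signals is linear regression, so a profile of affine strategies with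
coefficients `φ` is an equilibrium exactly when `φ` solves a linear integral equation. Precisely,
let `T` be the integral operator on `L²([0,1]; ℝ^(d+1))` with the matrix-valued kernel
`w(i,j) diag(1, P(i,j))`, and let `f` be the function with values `b(i) (μθ, σθ Pθ(i)) + c(i) e₀`.
The first-order condition `X i = 𝔼[Y i + b(i) θ + c(i) | S i]` for the Pettis integral `Y i` then
reads `φ = T φ + f`, at each agent with a square integrable weight section
(`LQGGame.isAffineEquilibrium_iff`). It rests on `SignalProcess.condExp_of_mem_gaussianSpan`
(residuals of regressions of jointly Gaussian variables are independent of the regressors),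
`LQGGame.condExp_of_isPettisIntegral` (the Pettis integral is tested against indicators of
signal events) and `exists_isPettisIntegral` (a Riesz representation).

The kernel is square integrable because `‖P(i,j)‖ ≤ 1` by Bessel's inequality, so `T` is a limit of
operators of finite rank and hence compact (`isCompactOperator_kernelOp`). By the Fredholm
alternative there is a unique affine equilibrium iff `1 - T` is invertible
(`LQGGame.hasUniqueAffineEquilibrium_iff`).

* Denseness: the eigenvalues of the compact operator `T` do not accumulate at `1`, so `1 - t T` is
  invertible for some `t` arbitrarily close to `1`, and `t T` belongs to the game with weights `t w`.
* Openness and convergence: `T` and `f` depend continuously on the game, where the products `w P`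
  and `b Pθ` are handled by truncating `w` and `b` and using that `P` and `Pθ` are uniformly bounded
  (`tendsto_eLpNorm_mul_of_bounded`). Invertibility is an open condition and inversion is
  continuous.
-/

/-! ### Eigenvalues of compact operators -/

namespace IsCompactOperator

variable {X : Type*} [NormedAddCommGroup X] [NormedSpace ℝ X] {T : X →L[ℝ] X}

open Module End in
/-- The eigenvalues of a compact operator do not accumulate away from `0`. Given infinitely many,
Riesz's lemma in the spans of the first `n` eigenvectors gives a bounded sequence whose image
under `T` is uniformly separated. -/
theorem finite_setOf_hasEigenvalue (hT : IsCompactOperator T) {r : ℝ} (hr : 0 < r) :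
    {μ : ℝ | r ≤ ‖μ‖ ∧ HasEigenvalue (T : End ℝ X) μ}.Finite := by
  by_contra hinf
  have hinf : {μ : ℝ | r ≤ ‖μ‖ ∧ HasEigenvalue (T : End ℝ X) μ}.Infinite := hinf
  obtain ⟨ev, hev⟩ : ∃ ev : ℕ → ℝ, Function.Injective ev ∧
      ∀ n, r ≤ ‖ev n‖ ∧ HasEigenvalue (T : End ℝ X) (ev n) :=
    ⟨fun n => hinf.natEmbedding _ n,
      fun a b h => (hinf.natEmbedding _).injective (Subtype.ext h),
      fun n => (hinf.natEmbedding _ n).2⟩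
  obtain ⟨ev_inj, hev⟩ := hev
  choose e he using fun n => (hev n).2.exists_hasEigenvector
  have hTe : ∀ n, T (e n) = ev n • e n := fun n => (he n).apply_eq_smul
  have e_li : LinearIndependent ℝ e :=
    eigenvectors_linearIndependent' (T : End ℝ X) ev ev_inj e he
  let V : ℕ → Submodule ℝ X := fun n => Submodule.span ℝ (e '' Iio n)
  have V_mono : Monotone V := fun m n h =>
    Submodule.span_mono (image_mono (Iio_subset_Iio h))
  have e_mem : ∀ {m n}, m < n → e m ∈ V n := fun h =>
    Submodule.subset_span (mem_image_of_mem e h)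
  have V_fin : ∀ n, FiniteDimensional ℝ (V n) := fun n =>
    FiniteDimensional.span_of_finite ℝ ((finite_Iio n).image e)
  have V_inv : ∀ n x, x ∈ V n → T x ∈ V n := by
    intro n x hx
    induction hx using Submodule.span_induction with
    | mem x hx =>
      obtain ⟨m, hm, rfl⟩ := hx
      rw [hTe]
      exact Submodule.smul_mem _ _ (e_mem hm)
    | zero => simp
    | add x y _ _ hx hy => rw [map_add]; exact add_mem hx hy
    | smul c x _ hx => rw [map_smul]; exact Submodule.smul_mem _ _ hx
  have V_step : ∀ n x, x ∈ V (n + 1) → T x - ev n • x ∈ V n := by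
    intro n x hx
    induction hx using Submodule.span_induction with
    | mem x hx =>
      obtain ⟨m, hm, rfl⟩ := hx
      rw [hTe]
      rcases (Nat.lt_succ_iff.1 hm).lt_or_eq with h | rfl
      · exact sub_mem (Submodule.smul_mem _ _ (e_mem h)) (Submodule.smul_mem _ _ (e_mem h))
      · simp
    | zero => simp
    | add x y _ _ hx hy =>
      rw [map_add, smul_add, add_sub_add_comm]; exact add_mem hx hy
    | smul c x _ hx =>
      rw [map_smul, smul_comm, ← smul_sub]; exact Submodule.smul_mem _ _ hx
  have key : ∀ n, ∃ x ∈ V (n + 1), ‖x‖ ≤ 3 ∧ ∀ y ∈ V n, 1 ≤ ‖x - y‖ := by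
    intro n
    have h1 : IsClosed ((V n).comap (V (n + 1)).subtype : Set (V (n + 1))) :=
      (Submodule.closed_of_finiteDimensional (V n)).preimage continuous_subtype_val
    have h2 : ∃ x : V (n + 1), x ∉ (V n).comap (V (n + 1)).subtype := by
      refine ⟨⟨e n, e_mem n.lt_succ_self⟩, fun h => ?_⟩
      have : e n ∈ Submodule.span ℝ (e '' Iio n) := h
      exact e_li.notMem_span_image (s := Iio n) (x := n) (by simp) this
    obtain ⟨⟨x, hx⟩, hxn, hxy⟩ := riesz_lemma_of_norm_lt (c := (2 : ℝ)) (R := 3)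
      (by norm_num) (by norm_num) h1 h2
    exact ⟨x, hx, hxn, fun y hy => hxy ⟨y, V_mono n.le_succ hy⟩ hy⟩
  choose x hx hxn hxy using key
  have sep : ∀ m n, m < n → r ≤ ‖T (x n) - T (x m)‖ := by
    intro m n hmn
    have hne : ev n ≠ 0 := norm_pos_iff.1 (hr.trans_le (hev n).1)
    set u : X := (ev n)⁻¹ • (T (x m) - (T (x n) - ev n • x n))
    have hu : u ∈ V n := Submodule.smul_mem _ _
      (sub_mem (V_inv n _ (V_mono hmn (hx m))) (V_step n _ (hx n)))
    have : T (x n) - T (x m) = ev n • (x n - u) := by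
      rw [smul_sub, smul_inv_smul₀ hne]; abel
    rw [this, norm_smul]
    nlinarith [(hev n).1, hxy n u hu]
  obtain ⟨K, hK, hK'⟩ := hT.image_closedBall_subset_compact 3
  obtain ⟨y, -, ψ, hψ, hψy⟩ := hK.tendsto_subseq (fun n => hK' ⟨x n, by simpa using hxn n, rfl⟩)
  obtain ⟨N, hN⟩ := Metric.cauchySeq_iff'.1 hψy.cauchySeq r hr
  have h := hN (N + 1) (Nat.le_succ N)
  rw [dist_eq_norm] at h
  exact absurd h (not_lt.2 (sep _ _ (hψ N.lt_succ_self)))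

variable [CompleteSpace X]

/-- The Fredholm alternative at the value `1`. -/
theorem isUnit_one_sub (hT : IsCompactOperator T) (h : ∀ x, T x = x → x = 0) :
    IsUnit (1 - T) := by
  rcases hT.hasEigenvalue_or_mem_resolventSet (one_ne_zero (α := ℝ)) with h1 | h1
  · obtain ⟨x, hx⟩ := h1.exists_hasEigenvector
    exact absurd (h x (by simpa using hx.apply_eq_smul)) hx.2
  · simpa [spectrum.mem_resolventSet_iff] using h1

/-- Scaling a compact operator by some factor arbitrarily close to `1` makes `1 - t • T`
invertible, since the eigenvalues of `T` do not accumulate at `1`. -/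
theorem exists_isUnit_one_sub_smul (hT : IsCompactOperator T) {ε : ℝ} (hε : 0 < ε) :
    ∃ t : ℝ, 1 < t ∧ t < 1 + ε ∧ IsUnit (1 - t • T) := by
  have hfin := hT.finite_setOf_hasEigenvalue (r := (1 + ε)⁻¹) (by positivity)
  have hinf : (Ioo (1 : ℝ) (1 + ε)).Infinite := Ioo_infinite (by linarith)
  have hinf' : ((fun t : ℝ => t⁻¹) '' Ioo (1 : ℝ) (1 + ε)).Infinite :=
    hinf.image inv_injective.injOn
  obtain ⟨_, ⟨t, ht, rfl⟩, hn⟩ := hinf'.exists_notMem_finite hfin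
  have ht0 : 0 < t := one_pos.trans ht.1
  refine ⟨t, ht.1, ht.2, isUnit_one_sub (hT.smul t) fun x hx => ?_⟩
  by_contra hx0
  refine hn ⟨?_, Module.End.hasEigenvalue_of_hasEigenvector (x := x) ⟨?_, hx0⟩⟩
  · rw [norm_inv, Real.norm_of_nonneg ht0.le]
    exact inv_anti₀ ht0 ht.2.le
  · rw [Module.End.mem_genEigenspace_one]
    have hx : t • T x = x := hx
    calc T x = t⁻¹ • t • T x := (inv_smul_smul₀ ht0.ne' _).symm
      _ = t⁻¹ • x := by rw [hx]

end IsCompactOperator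

/-! ### Hilbert–Schmidt integral operators -/

section KernelOperator

variable {α E : Type*} [MeasurableSpace α] {μ : Measure α} [NormedAddCommGroup E]
  [NormedSpace ℝ E]

/-- The function `i ↦ ∫ κ(i,j) φ(j) dμ(j)` for an operator-valued kernel `κ`. -/
noncomputable def integralTransform (μ : Measure α) (κ : α × α → E →L[ℝ] E) (φ : α → E) (i : α) :
    E :=
  ∫ j, κ (i, j) (φ j) ∂μ

theorem integrable_clm_apply {k : α → E →L[ℝ] E} {φ : α → E} (hk : MemLp k 2 μ)
    (hφ : MemLp φ 2 μ) : Integrable (fun j => k j (φ j)) μ := by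
  have hm : AEStronglyMeasurable (fun j => k j (φ j)) μ :=
    isBoundedBilinearMap_apply.continuous.comp_aestronglyMeasurable₂ hk.1 hφ.1
  refine memLp_one_iff_integrable.1 (MemLp.of_bilin (fun (A : E →L[ℝ] E) v => A v) 1 hk hφ hm ?_)
  exact ae_of_all _ fun j => by simpa using (k j).le_opNNNorm (φ j)

theorem enorm_integral_clm_apply_le {k : α → E →L[ℝ] E} {φ : α → E}
    (hk : AEStronglyMeasurable k μ) (hφ : AEStronglyMeasurable φ μ) :
    ‖∫ j, k j (φ j) ∂μ‖ₑ ≤ eLpNorm k 2 μ * eLpNorm φ 2 μ := by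
  refine (enorm_integral_le_lintegral_enorm _).trans ?_
  rw [← eLpNorm_one_eq_lintegral_enorm]
  simpa using eLpNorm_le_eLpNorm_mul_eLpNorm_of_nnnorm (p := 2) (q := 2) (r := 1) hk hφ
    (fun (A : E →L[ℝ] E) v => A v) 1
    (ae_of_all _ fun j => by simpa using (k j).le_opNNNorm (φ j))

theorem integralTransform_congr {κ : α × α → E →L[ℝ] E} {φ ψ : α → E} (h : φ =ᵐ[μ] ψ) :
    integralTransform μ κ φ = integralTransform μ κ ψ := by
  ext i
  refine integral_congr_ae ?_
  filter_upwards [h] with j hj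
  rw [hj]

theorem integralTransform_add {κ : α × α → E →L[ℝ] E} {φ ψ : α → E} {i : α}
    (hκ : MemLp (fun j => κ (i, j)) 2 μ) (hφ : MemLp φ 2 μ) (hψ : MemLp ψ 2 μ) :
    integralTransform μ κ (φ + ψ) i = integralTransform μ κ φ i + integralTransform μ κ ψ i := by
  simp only [integralTransform, Pi.add_apply, map_add]
  exact integral_add (integrable_clm_apply hκ hφ) (integrable_clm_apply hκ hψ)

theorem eLpNorm_two_sq {F : Type*} [NormedAddCommGroup F] (f : α → F) :
    eLpNorm f 2 μ ^ 2 = ∫⁻ x, ‖f x‖ₑ ^ 2 ∂μ := by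
  simpa using eLpNorm_nnreal_pow_eq_lintegral (μ := μ) (f := f) (p := 2) (by norm_num)

variable [IsFiniteMeasure μ]

theorem lintegral_eLpNorm_section_sq {F : Type*} [NormedAddCommGroup F] {κ : α × α → F}
    (hκ : AEStronglyMeasurable κ (μ.prod μ)) :
    ∫⁻ i, eLpNorm (fun j => κ (i, j)) 2 μ ^ 2 ∂μ = eLpNorm κ 2 (μ.prod μ) ^ 2 := by
  rw [eLpNorm_two_sq, lintegral_prod _ (hκ.enorm.pow_const 2)]
  simp_rw [eLpNorm_two_sq]

theorem aestronglyMeasurable_integralTransform {κ : α × α → E →L[ℝ] E} {φ : α → E}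
    (hκ : AEStronglyMeasurable κ (μ.prod μ)) (hφ : AEStronglyMeasurable φ μ) :
    AEStronglyMeasurable (integralTransform μ κ φ) μ :=
  AEStronglyMeasurable.integral_prod_right' (f := fun p : α × α => κ p (φ p.2))
    (isBoundedBilinearMap_apply.continuous.comp_aestronglyMeasurable₂ hκ hφ.comp_snd)

theorem ae_memLp_section {F : Type*} [NormedAddCommGroup F] {κ : α × α → F}
    (hκ : MemLp κ 2 (μ.prod μ)) : ∀ᵐ i ∂μ, MemLp (fun j => κ (i, j)) 2 μ := by
  filter_upwards [hκ.integrable_norm_pow'.prod_right_ae, hκ.1.prodMk_left] with i hi hm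
  rw [memLp_two_iff_integrable_sq_norm hm]
  simpa using hi

theorem eLpNorm_integralTransform_le {κ : α × α → E →L[ℝ] E} {φ : α → E}
    (hκ : AEStronglyMeasurable κ (μ.prod μ)) (hφ : AEStronglyMeasurable φ μ) :
    eLpNorm (integralTransform μ κ φ) 2 μ ≤ eLpNorm κ 2 (μ.prod μ) * eLpNorm φ 2 μ := by
  rw [← ENNReal.pow_le_pow_left_iff two_ne_zero]
  calc eLpNorm (integralTransform μ κ φ) 2 μ ^ 2
      = ∫⁻ i, ‖integralTransform μ κ φ i‖ₑ ^ 2 ∂μ := eLpNorm_two_sq _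
    _ ≤ ∫⁻ i, eLpNorm (fun j => κ (i, j)) 2 μ ^ 2 * eLpNorm φ 2 μ ^ 2 ∂μ := by
        refine lintegral_mono_ae ?_
        filter_upwards [hκ.prodMk_left] with i hi
        rw [← mul_pow]
        gcongr
        exact enorm_integral_clm_apply_le hi hφ
    _ = (eLpNorm κ 2 (μ.prod μ) * eLpNorm φ 2 μ) ^ 2 := by
        rw [mul_pow, ← lintegral_eLpNorm_section_sq hκ, lintegral_mul_const'']
        simp_rw [eLpNorm_two_sq]
        exact (hκ.enorm.pow_const 2).lintegral_prod_right'

theorem memLp_integralTransform {κ : α × α → E →L[ℝ] E} {φ : α → E}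
    (hκ : MemLp κ 2 (μ.prod μ)) (hφ : MemLp φ 2 μ) : MemLp (integralTransform μ κ φ) 2 μ :=
  ⟨aestronglyMeasurable_integralTransform hκ.1 hφ.1,
    (eLpNorm_integralTransform_le hκ.1 hφ.1).trans_lt (ENNReal.mul_lt_top hκ.2 hφ.2)⟩

/-- The Hilbert–Schmidt operator on `L²(μ; E)` with kernel `κ`. -/
noncomputable def kernelOp (κ : α × α → E →L[ℝ] E) (hκ : MemLp κ 2 (μ.prod μ)) :
    Lp E 2 μ →L[ℝ] Lp E 2 μ :=
  LinearMap.mkContinuous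
    { toFun := fun φ => (memLp_integralTransform hκ (Lp.memLp φ)).toLp (integralTransform μ κ φ)
      map_add' := fun φ ψ => by
        rw [← MemLp.toLp_add, MemLp.toLp_eq_toLp_iff, integralTransform_congr (Lp.coeFn_add φ ψ)]
        filter_upwards [ae_memLp_section hκ] with i hi
        exact integralTransform_add hi (Lp.memLp φ) (Lp.memLp ψ)
      map_smul' := fun c φ => by
        rw [RingHom.id_apply, ← MemLp.toLp_const_smul, MemLp.toLp_eq_toLp_iff,
          integralTransform_congr (Lp.coeFn_smul c φ)]
        refine ae_of_all _ fun i => ?_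
        simp only [integralTransform, Pi.smul_apply, map_smul, integral_smul] }
    (eLpNorm κ 2 (μ.prod μ)).toReal fun φ => by
      rw [LinearMap.coe_mk, AddHom.coe_mk, Lp.norm_toLp, Lp.norm_def, ← ENNReal.toReal_mul]
      exact ENNReal.toReal_mono (ENNReal.mul_lt_top hκ.2 (Lp.memLp φ).2).ne
        (eLpNorm_integralTransform_le hκ.1 (Lp.memLp φ).1)

theorem kernelOp_apply {κ : α × α → E →L[ℝ] E} (hκ : MemLp κ 2 (μ.prod μ)) (φ : Lp E 2 μ) :
    kernelOp κ hκ φ =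
      (memLp_integralTransform hκ (Lp.memLp φ)).toLp (integralTransform μ κ φ) := rfl

theorem coeFn_kernelOp {κ : α × α → E →L[ℝ] E} (hκ : MemLp κ 2 (μ.prod μ)) (φ : Lp E 2 μ) :
    kernelOp κ hκ φ =ᵐ[μ] integralTransform μ κ φ :=
  MemLp.coeFn_toLp (memLp_integralTransform hκ (Lp.memLp φ))

theorem norm_kernelOp_le {κ : α × α → E →L[ℝ] E} (hκ : MemLp κ 2 (μ.prod μ)) :
    ‖kernelOp κ hκ‖ ≤ (eLpNorm κ 2 (μ.prod μ)).toReal :=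
  LinearMap.mkContinuous_norm_le _ ENNReal.toReal_nonneg _

theorem kernelOp_congr {κ κ' : α × α → E →L[ℝ] E} (hκ : MemLp κ 2 (μ.prod μ))
    (hκ' : MemLp κ' 2 (μ.prod μ)) (h : κ =ᵐ[μ.prod μ] κ') : kernelOp κ hκ = kernelOp κ' hκ' := by
  ext1 φ
  rw [kernelOp_apply, kernelOp_apply, MemLp.toLp_eq_toLp_iff]
  filter_upwards [Measure.ae_ae_of_ae_prod h] with i hi
  refine integral_congr_ae ?_
  filter_upwards [hi] with j hj
  rw [hj]

theorem kernelOp_add {κ κ' : α × α → E →L[ℝ] E} (hκ : MemLp κ 2 (μ.prod μ))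
    (hκ' : MemLp κ' 2 (μ.prod μ)) (hs : MemLp (κ + κ') 2 (μ.prod μ)) :
    kernelOp (κ + κ') hs = kernelOp κ hκ + kernelOp κ' hκ' := by
  ext1 φ
  ext1
  filter_upwards [coeFn_kernelOp hs φ, coeFn_kernelOp hκ φ, coeFn_kernelOp hκ' φ,
    Lp.coeFn_add (kernelOp κ hκ φ) (kernelOp κ' hκ' φ), ae_memLp_section hκ,
    ae_memLp_section hκ'] with i h h1 h2 h3 hi hi'
  rw [h, _root_.add_apply, h3, Pi.add_apply, h1, h2]
  exact integral_add (integrable_clm_apply hi (Lp.memLp φ)) (integrable_clm_apply hi' (Lp.memLp φ))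

theorem kernelOp_const_smul {κ : α × α → E →L[ℝ] E} (hκ : MemLp κ 2 (μ.prod μ)) (c : ℝ) :
    kernelOp (c • κ) (hκ.const_smul c) = c • kernelOp κ hκ := by
  ext1 φ
  ext1
  filter_upwards [coeFn_kernelOp (hκ.const_smul c) φ, coeFn_kernelOp hκ φ,
    Lp.coeFn_smul c (kernelOp κ hκ φ)] with i h h1 h2
  rw [h, _root_.smul_apply, h2, Pi.smul_apply, h1]
  exact integral_smul c _

theorem norm_kernelOp_sub_le {κ κ' : α × α → E →L[ℝ] E} (hκ : MemLp κ 2 (μ.prod μ))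
    (hκ' : MemLp κ' 2 (μ.prod μ)) :
    ‖kernelOp κ hκ - kernelOp κ' hκ'‖ ≤ (eLpNorm (κ - κ') 2 (μ.prod μ)).toReal := by
  have h := kernelOp_add (hκ.sub hκ') hκ' (by simpa using hκ)
  rw [kernelOp_congr _ hκ (by simp), ← sub_eq_iff_eq_add] at h
  rw [h]
  exact norm_kernelOp_le _

variable [FiniteDimensional ℝ E]

/-- The kernel `1_{s × t} c` gives the operator `φ ↦ 1_s c(∫_t φ)`, which has finite rank. -/
theorem isCompactOperator_kernelOp_rectangle {s t : Set α} (hs : MeasurableSet s)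
    (ht : MeasurableSet t) (c : E →L[ℝ] E)
    (h : MemLp ((s ×ˢ t).indicator fun _ : α × α => c) 2 (μ.prod μ)) :
    IsCompactOperator (kernelOp _ h) := by
  have hk : MemLp (t.indicator fun _ : α => c) 2 μ :=
    memLp_indicator_const 2 ht c (Or.inr (measure_ne_top _ _))
  let A : Lp E 2 μ →L[ℝ] E := LinearMap.mkContinuous
    { toFun := fun φ => ∫ j, t.indicator (fun _ => c) j (φ j) ∂μ
      map_add' := fun φ ψ => by
        rw [← integral_add (integrable_clm_apply hk (Lp.memLp φ))
          (integrable_clm_apply hk (Lp.memLp ψ))]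
        refine integral_congr_ae ?_
        filter_upwards [Lp.coeFn_add φ ψ] with j hj
        rw [hj, Pi.add_apply, map_add]
      map_smul' := fun a φ => by
        rw [RingHom.id_apply, ← integral_smul]
        refine integral_congr_ae ?_
        filter_upwards [Lp.coeFn_smul a φ] with j hj
        rw [hj, Pi.smul_apply, map_smul] }
    (eLpNorm (t.indicator fun _ : α => c) 2 μ).toReal fun φ => by
      rw [LinearMap.coe_mk, AddHom.coe_mk, Lp.norm_def, ← ENNReal.toReal_mul, ← toReal_enorm]
      exact ENNReal.toReal_mono (ENNReal.mul_lt_top hk.2 (Lp.memLp φ).2).ne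
        (enorm_integral_clm_apply_le hk.1 (Lp.memLp φ).1)
  let B : E →L[ℝ] Lp E 2 μ := LinearMap.toContinuousLinearMap
    { toFun := fun e => indicatorConstLp 2 hs (measure_ne_top μ s) e
      map_add' := fun e f => indicatorConstLp_add.symm
      map_smul' := fun a e => by
        ext1
        filter_upwards [indicatorConstLp_coeFn (p := 2) (hs := hs) (hμs := measure_ne_top μ s)
            (c := a • e), indicatorConstLp_coeFn (p := 2) (hs := hs)
            (hμs := measure_ne_top μ s) (c := e),
          Lp.coeFn_smul a (indicatorConstLp 2 hs (measure_ne_top μ s) e)] with i h1 h2 h3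
        rw [RingHom.id_apply, h1, h3, Pi.smul_apply, h2]
        by_cases hi : i ∈ s <;> simp [hi] }
  have hAB : kernelOp _ h = B ∘L A := by
    ext1 φ
    ext1
    filter_upwards [coeFn_kernelOp h φ, indicatorConstLp_coeFn (p := 2) (hs := hs)
      (hμs := measure_ne_top μ s) (c := A φ)] with i h1 h2
    rw [h1]
    refine Eq.trans ?_ h2.symm
    by_cases hi : i ∈ s
    · rw [indicator_of_mem hi]
      refine integral_congr_ae (ae_of_all _ fun j => ?_)
      by_cases hj : j ∈ t <;> simp [hi, hj]
    · rw [indicator_of_notMem hi, integralTransform]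
      simp [hi]
  rw [hAB]
  have : ProperSpace E := FiniteDimensional.proper_real E
  exact (isCompactOperator_of_locallyCompactSpace_rng B).comp_clm A

/-- The measurable sets `s ⊆ α × α` whose kernel `1_s c` gives a compact operator form a
`λ`-system that contains the rectangles. -/
theorem isCompactOperator_kernelOp_indicator (c : E →L[ℝ] E) {s : Set (α × α)}
    (hs : MeasurableSet s) (h : MemLp (s.indicator fun _ : α × α => c) 2 (μ.prod μ)) :
    IsCompactOperator (kernelOp _ h) := by
  have hmem : ∀ {s : Set (α × α)}, MeasurableSet s →
      MemLp (s.indicator fun _ : α × α => c) 2 (μ.prod μ) := fun hs =>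
    memLp_indicator_const 2 hs c (Or.inr (measure_ne_top _ _))
  have hadd : ∀ {s t : Set (α × α)} (hs : MeasurableSet s) (ht : MeasurableSet t), Disjoint s t →
      kernelOp _ (hmem (hs.union ht)) = kernelOp _ (hmem hs) + kernelOp _ (hmem ht) := by
    intro s t hs ht hst
    have heq := indicator_union_of_disjoint hst fun _ : α × α => c
    rw [← kernelOp_add _ _ (heq ▸ hmem (hs.union ht) :)]
    exact kernelOp_congr _ _ (Eq.eventuallyEq heq)
  induction s, hs using MeasurableSpace.induction_on_inter generateFrom_prod.symm
    isPiSystem_prod with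
  | empty =>
    have := isCompactOperator_kernelOp_rectangle (μ := μ) MeasurableSet.empty MeasurableSet.empty c
      (hmem (MeasurableSet.empty.prod .empty))
    rwa [kernelOp_congr _ h (by simp)] at this
  | basic s hs =>
    obtain ⟨a, ha, b, hb, rfl⟩ := hs
    exact isCompactOperator_kernelOp_rectangle ha hb c h
  | compl s hs ih =>
    have hu := isCompactOperator_kernelOp_rectangle (μ := μ) .univ .univ c
      (hmem (MeasurableSet.univ.prod .univ))
    have heq : kernelOp _ h = kernelOp _ (hmem (MeasurableSet.univ.prod .univ)) -
        kernelOp _ (hmem hs) := by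
      rw [eq_sub_iff_add_eq', ← hadd hs hs.compl disjoint_compl_right]
      exact kernelOp_congr _ _ (by simp)
    rw [heq]
    exact hu.sub (ih _)
  | iUnion f hd hf ih =>
    have hfin : ∀ n, MeasurableSet (⋃ i ∈ Finset.range n, f i) := fun n =>
      Finset.measurableSet_biUnion _ fun i _ => hf i
    have htail : ∀ n, MeasurableSet (⋃ i ≥ n, f i) := fun n =>
      MeasurableSet.iUnion fun i => MeasurableSet.iUnion fun _ => hf i
    have hcpt : ∀ n, IsCompactOperator (kernelOp _ (hmem (hfin n))) := by
      intro n
      induction n with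
      | zero =>
        have := isCompactOperator_kernelOp_rectangle (μ := μ) MeasurableSet.empty
          MeasurableSet.empty c (hmem (MeasurableSet.empty.prod .empty))
        rwa [kernelOp_congr _ (hmem (hfin 0)) (by simp)] at this
      | succ n ihn =>
        have hdisj : Disjoint (f n) (⋃ i ∈ Finset.range n, f i) := by
          simp only [disjoint_iUnion_right, Finset.mem_range]
          exact fun i hi => hd hi.ne'
        rw [kernelOp_congr _ (hmem ((hf n).union (hfin n)))
          (by rw [Finset.range_add_one, Finset.set_biUnion_insert]), hadd (hf n) (hfin n) hdisj]
        exact (ih n _).add ihn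
    have hsplit : ∀ n, kernelOp _ h - kernelOp _ (hmem (hfin n)) = kernelOp _ (hmem (htail n)) := by
      intro n
      have hdisj : Disjoint (⋃ i ∈ Finset.range n, f i) (⋃ i ≥ n, f i) := by
        simp only [disjoint_iUnion_right, disjoint_iUnion_left, Finset.mem_range]
        exact fun i hi j hj => hd (hj.trans_le hi).ne
      rw [sub_eq_iff_eq_add', ← hadd (hfin n) (htail n) hdisj]
      refine kernelOp_congr _ _ (Eq.eventuallyEq ?_)
      congr 1
      ext x
      simp only [mem_iUnion, mem_union, Finset.mem_range, exists_prop]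
      constructor
      · rintro ⟨i, hi⟩
        rcases lt_or_ge i n with h | h
        exacts [Or.inl ⟨i, h, hi⟩, Or.inr ⟨i, h, hi⟩]
      · rintro (⟨i, -, hi⟩ | ⟨i, -, hi⟩) <;> exact ⟨i, hi⟩
    refine isCompactOperator_of_tendsto (l := atTop) (F := fun n => kernelOp _ (hmem (hfin n))) ?_
      (Eventually.of_forall hcpt)
    rw [tendsto_iff_norm_sub_tendsto_zero]
    have hμ := tendsto_measure_biUnion_Ici_zero_of_pairwise_disjoint (μ := μ.prod μ)
      (fun i => (hf i).nullMeasurableSet) hd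
    have h1 : Tendsto (fun n => (‖c‖ₑ * (μ.prod μ) (⋃ i ≥ n, f i) ^ (1 / (2 : ℝ))).toReal)
        atTop (𝓝 0) := by
      have h2 := ENNReal.Tendsto.const_mul (a := ‖c‖ₑ) ((ENNReal.continuous_rpow_const
        (y := 1 / (2 : ℝ))).continuousAt.tendsto.comp hμ) (Or.inr enorm_ne_top)
      simp only [Function.comp_def] at h2
      rw [ENNReal.zero_rpow_of_pos (by norm_num), mul_zero] at h2
      exact (ENNReal.tendsto_toReal ENNReal.zero_ne_top).comp h2
    refine squeeze_zero (fun _ => norm_nonneg _) (fun n => ?_) h1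
    rw [norm_sub_rev, hsplit]
    refine (norm_kernelOp_le _).trans_eq ?_
    rw [eLpNorm_indicator_const (c := c) (htail n) two_ne_zero ENNReal.ofNat_ne_top]
    norm_num

theorem isCompactOperator_kernelOp {κ : α × α → E →L[ℝ] E} (hκ : MemLp κ 2 (μ.prod μ)) :
    IsCompactOperator (kernelOp κ hκ) := by
  refine MemLp.induction ENNReal.ofNat_ne_top
    (motive := fun κ => ∀ h : MemLp κ 2 (μ.prod μ), IsCompactOperator (kernelOp κ h))
    ?_ ?_ ?_ ?_ hκ hκ
  · exact fun c s hs _ h => isCompactOperator_kernelOp_indicator c hs h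
  · intro f g _ hf hg ihf ihg h
    rw [kernelOp_add hf hg h]
    exact (ihf hf).add (ihg hg)
  · refine IsSeqClosed.isClosed fun f g hf hfg hg => ?_
    refine isCompactOperator_of_tendsto (l := atTop)
      (F := fun n => kernelOp (f n) (Lp.memLp (f n))) ?_ (Eventually.of_forall fun n => hf n _)
    rw [tendsto_iff_norm_sub_tendsto_zero] at hfg ⊢
    refine squeeze_zero (fun _ => norm_nonneg _) (fun n => ?_) hfg
    refine (norm_kernelOp_sub_le _ _).trans_eq ?_
    rw [Lp.norm_def, eLpNorm_congr_ae (Lp.coeFn_sub _ _)]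
  · intro f g hfg hf ih h
    rw [← kernelOp_congr hf h hfg]
    exact ih hf

end KernelOperator

/-! ### Inverse square roots of positive definite matrices -/

section InvSqrt

open scoped MatrixOrder

variable {d : ℕ} {A : Matrix (Fin d) (Fin d) ℝ}

theorem invSqrt_mul_self (hA : A.PosDef) : invSqrt A * invSqrt A = A⁻¹ :=
  CFC.sqrt_mul_sqrt_self A⁻¹ hA.inv.posSemidef.nonneg

theorem isSymm_invSqrt (A : Matrix (Fin d) (Fin d) ℝ) : (invSqrt A).IsSymm := by
  have h := (Matrix.nonneg_iff_posSemidef.1 (CFC.sqrt_nonneg A⁻¹)).isHermitian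
  rwa [Matrix.IsHermitian, Matrix.conjTranspose_eq_transpose_of_trivial] at h

theorem mul_invSqrt_mul_invSqrt (hA : A.PosDef) : A * invSqrt A * invSqrt A = 1 := by
  rw [mul_assoc, invSqrt_mul_self hA, Matrix.mul_nonsing_inv _ hA.det_pos.ne'.isUnit]

theorem invSqrt_mul_mul_invSqrt (hA : A.PosDef) : invSqrt A * A * invSqrt A = 1 := by
  have h := mul_invSqrt_mul_invSqrt hA
  rw [mul_assoc]
  exact mul_eq_one_comm.1 h

end InvSqrt

/-! ### The whitened signals -/

theorem ProbabilityTheory.IsGaussianProcess.of_mem_span {Ω T S : Type*} [MeasurableSpace Ω]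
    {Pr : Measure Ω} {X : T → Ω → ℝ} (hX : IsGaussianProcess X Pr) {Y : S → Ω → ℝ}
    (hY : ∀ s, Y s ∈ Submodule.span ℝ (range X)) : IsGaussianProcess Y Pr := by
  refine hX.of_isGaussianProcess fun s => ?_
  obtain ⟨c, hc⟩ := Finsupp.mem_span_range_iff_exists_finsupp.1 (hY s)
  refine ⟨c.support, ∑ t : c.support, c t • ContinuousLinearMap.proj t, fun ω => ?_⟩
  rw [← hc, Finsupp.sum, Finset.sum_apply, ← Finset.sum_coe_sort]
  simp

namespace SignalProcess

variable {d : ℕ} {μθ σθ : ℝ} (Q : SignalProcess.{u} d μθ σθ)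

/-- The linear span of the state and of all signal components, as functions on `Ω`. -/
def gaussianSpan : Submodule ℝ (Q.Ω → ℝ) :=
  Submodule.span ℝ (range fun (t : Option (unitInterval × Fin d)) (ω : Q.Ω) =>
    t.elim (Q.θ ω) fun p => Q.S p.1 ω p.2)

/-- The standardized signal `K(i,i)^(-1/2) (S i - m i)`. -/
noncomputable def std (i : unitInterval) (k : Fin d) (ω : Q.Ω) : ℝ :=
  (invSqrt (Q.K i i)).mulVec (Q.S i ω - Q.m i) k

variable {Q}

theorem θ_mem_gaussianSpan : Q.θ ∈ Q.gaussianSpan :=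
  Submodule.subset_span ⟨none, rfl⟩

theorem S_mem_gaussianSpan (i : unitInterval) (k : Fin d) :
    (fun ω => Q.S i ω k) ∈ Q.gaussianSpan :=
  Submodule.subset_span ⟨some (i, k), rfl⟩

theorem memLp_of_mem_gaussianSpan {V : Q.Ω → ℝ} (hV : V ∈ Q.gaussianSpan) : MemLp V 2 Q.Pr :=
  ((Q.gaussian.of_mem_span (Y := fun _ : Unit => V) fun _ => hV).hasGaussianLaw_eval ()).memLp_two

theorem measurable_of_mem_gaussianSpan {V : Q.Ω → ℝ} (hV : V ∈ Q.gaussianSpan) :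
    Measurable V := by
  induction hV using Submodule.span_induction with
  | mem V hV =>
    obtain ⟨_ | ⟨i, k⟩, rfl⟩ := hV
    exacts [Q.measurable_θ, (measurable_pi_apply k).comp (Q.measurable_S i)]
  | zero => exact measurable_zero
  | add V W _ _ hV hW => exact hV.add hW
  | smul c V _ hV => exact hV.const_smul c

variable (Q)

theorem memLp_θ : MemLp Q.θ 2 Q.Pr := memLp_of_mem_gaussianSpan θ_mem_gaussianSpan

theorem memLp_S (i : unitInterval) (k : Fin d) : MemLp (fun ω => Q.S i ω k) 2 Q.Pr :=
  memLp_of_mem_gaussianSpan (S_mem_gaussianSpan i k)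

theorem std_eq (i : unitInterval) (k : Fin d) :
    Q.std i k = fun ω => ∑ l, invSqrt (Q.K i i) k l * (Q.S i ω l - Q.m i l) := rfl

theorem measurable_std (i : unitInterval) (k : Fin d) : Measurable (Q.std i k) := by
  rw [std_eq]
  have := fun l => (measurable_pi_apply l).comp (Q.measurable_S i)
  exact Finset.measurable_sum _ fun l _ => ((this l).sub_const _).const_mul _

theorem memLp_std (i : unitInterval) (k : Fin d) : MemLp (Q.std i k) 2 Q.Pr := by
  rw [std_eq]
  exact memLp_finsetSum _ fun l _ => ((Q.memLp_S i l).sub (memLp_const (Q.m i l))).const_mul _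

theorem memLp_const_mul_S_sub (i : unitInterval) (k : Fin d) (a c : ℝ) :
    MemLp (fun ω => a * (Q.S i ω k - c)) 2 Q.Pr :=
  ((Q.memLp_S i k).sub (memLp_const c)).const_mul a

theorem integral_std (i : unitInterval) (k : Fin d) : ∫ ω, Q.std i k ω ∂Q.Pr = 0 := by
  have h : ∀ l, Integrable (fun ω => Q.S i ω l) Q.Pr := fun l =>
    (Q.memLp_S i l).integrable one_le_two
  simp only [std_eq]
  rw [integral_finsetSum _ fun l _ => (Q.memLp_const_mul_S_sub i l _ _).integrable one_le_two]
  refine Finset.sum_eq_zero fun l _ => ?_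
  rw [integral_const_mul, integral_sub (h l) (integrable_const _)]
  simp [m]

theorem covariance_std_left {Z : Q.Ω → ℝ} (hZ : MemLp Z 2 Q.Pr) (i : unitInterval) (k : Fin d) :
    cov[Q.std i k, Z; Q.Pr] =
      ∑ l, invSqrt (Q.K i i) k l * cov[fun ω => Q.S i ω l, Z; Q.Pr] := by
  rw [std_eq, covariance_fun_sum_left (fun l => Q.memLp_const_mul_S_sub i l _ _) hZ]
  refine Finset.sum_congr rfl fun l _ => ?_
  rw [covariance_const_mul_left, covariance_sub_const_left ((Q.memLp_S i l).integrable one_le_two)]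

theorem covariance_std_θ (hσ : 0 < σθ) (i : unitInterval) (k : Fin d) :
    cov[Q.std i k, Q.θ; Q.Pr] = σθ * Q.Pθ i k := by
  rw [covariance_std_left _ Q.memLp_θ, Pθ, Pi.smul_apply, smul_eq_mul, ← mul_assoc,
    mul_one_div_cancel hσ.ne', one_mul]
  rfl

theorem covariance_std_std (i j : unitInterval) (k l : Fin d) :
    cov[Q.std i k, Q.std j l; Q.Pr] = Q.P i j k l := by
  rw [covariance_std_left _ (Q.memLp_std j l), P, Matrix.mul_assoc, Matrix.mul_apply]
  refine Finset.sum_congr rfl fun a _ => ?_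
  rw [covariance_comm, covariance_std_left _ (Q.memLp_S i a), Matrix.mul_apply]
  congr 1
  refine Finset.sum_congr rfl fun b _ => ?_
  rw [covariance_comm, mul_comm, (isSymm_invSqrt (Q.K j j)).apply]
  rfl

theorem P_transpose (i j : unitInterval) (k l : Fin d) : Q.P i j k l = Q.P j i l k := by
  rw [← covariance_std_std, covariance_comm, covariance_std_std]

theorem posDef_K (i : unitInterval) : (Q.K i i).PosDef := by
  have hsymm : (Q.K i i).IsHermitian := by
    ext k l
    simp only [Matrix.conjTranspose_apply, K, Matrix.of_apply, star_trivial]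
    exact covariance_comm _ _
  have hpsd : (Q.K i i).PosSemidef := by
    refine .of_dotProduct_mulVec_nonneg hsymm fun x => ?_
    have hm : ∀ k, MemLp (fun ω => x k * Q.S i ω k) 2 Q.Pr := fun k =>
      (Q.memLp_S i k).const_mul _
    have hsum : star x ⬝ᵥ (Q.K i i).mulVec x =
        cov[fun ω => ∑ k, x k * Q.S i ω k, fun ω => ∑ k, x k * Q.S i ω k; Q.Pr] := by
      rw [covariance_fun_sum_fun_sum hm hm]
      simp only [dotProduct, Matrix.mulVec, Pi.star_apply, star_trivial, Finset.mul_sum]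
      refine Finset.sum_congr rfl fun k _ => Finset.sum_congr rfl fun l _ => ?_
      rw [covariance_const_mul_left, covariance_const_mul_right, K, Matrix.of_apply]
      ring
    rw [hsum, covariance_self (memLp_finsetSum _ fun k _ => hm k).1.aemeasurable]
    exact variance_nonneg _ _
  refine hpsd.posDef_iff_isUnit.2 ?_
  have h := Q.invertible_cov {i}
  let e : Fin d ≃ ({i} : Finset unitInterval) × Fin d :=
    (Equiv.uniqueProd (Fin d) ({i} : Finset unitInterval)).symm
  exact (Matrix.isUnit_submatrix_equiv e e).2 h

theorem P_self (i : unitInterval) : Q.P i i = 1 := invSqrt_mul_mul_invSqrt (Q.posDef_K i)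

/-- The signals are recovered from the standardized signals. -/
theorem S_eq (i : unitInterval) (ω : Q.Ω) :
    Q.S i ω = Q.m i + (Q.K i i * invSqrt (Q.K i i)).mulVec fun k => Q.std i k ω := by
  have h : (fun k => Q.std i k ω) = (invSqrt (Q.K i i)).mulVec (Q.S i ω - Q.m i) := rfl
  rw [h, Matrix.mulVec_mulVec, mul_invSqrt_mul_invSqrt (Q.posDef_K i), Matrix.one_mulVec]
  abel

variable {Q}

theorem memLp_sum_std (i : unitInterval) (a : Fin d → ℝ) :
    MemLp (fun ω => ∑ k, a k * Q.std i k ω) 2 Q.Pr :=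
  memLp_finsetSum _ fun k _ => (Q.memLp_std i k).const_mul _

theorem integral_sum_std (i : unitInterval) (a : Fin d → ℝ) :
    ∫ ω, ∑ k, a k * Q.std i k ω ∂Q.Pr = 0 := by
  rw [integral_finsetSum _ fun k _ => ((Q.memLp_std i k).integrable one_le_two).const_mul _]
  simp [integral_const_mul, integral_std]

theorem covariance_sum_std_left {Z : Q.Ω → ℝ} (hZ : MemLp Z 2 Q.Pr) (i : unitInterval)
    (a : Fin d → ℝ) :
    cov[fun ω => ∑ k, a k * Q.std i k ω, Z; Q.Pr] = ∑ k, a k * cov[Q.std i k, Z; Q.Pr] := by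
  rw [covariance_fun_sum_left (fun k => (Q.memLp_std i k).const_mul _) hZ]
  simp only [covariance_const_mul_left]

theorem covariance_sum_std_std (i j : unitInterval) (v : Fin d → ℝ) (k : Fin d) :
    cov[fun ω => ∑ l, v l * Q.std j l ω, Q.std i k; Q.Pr] = (Q.P i j).mulVec v k := by
  rw [covariance_sum_std_left (Q.memLp_std i k)]
  refine Finset.sum_congr rfl fun l _ => ?_
  rw [covariance_std_std, P_transpose, mul_comm]

theorem covariance_sum_std_sum_std (i j : unitInterval) (u v : Fin d → ℝ) :
    cov[fun ω => ∑ k, u k * Q.std i k ω, fun ω => ∑ l, v l * Q.std j l ω; Q.Pr] =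
      u ⬝ᵥ (Q.P i j).mulVec v := by
  rw [covariance_sum_std_left (memLp_sum_std j v)]
  refine Finset.sum_congr rfl fun k _ => ?_
  rw [covariance_comm, covariance_sum_std_std]

/-- Bessel's inequality for the uncorrelated components of a standardized signal. -/
theorem sum_covariance_std_sq_le {V : Q.Ω → ℝ} (hV : MemLp V 2 Q.Pr) (i : unitInterval) :
    ∑ k, cov[V, Q.std i k; Q.Pr] ^ 2 ≤ cov[V, V; Q.Pr] := by
  set a : Fin d → ℝ := fun k => cov[V, Q.std i k; Q.Pr] with ha
  have hW := memLp_sum_std (Q := Q) i a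
  have h := variance_nonneg (fun ω => V ω - ∑ k, a k * Q.std i k ω) Q.Pr
  have hself : cov[fun ω => ∑ k, a k * Q.std i k ω, V; Q.Pr] = ∑ k, a k ^ 2 := by
    rw [covariance_sum_std_left hV]
    refine Finset.sum_congr rfl fun k _ => ?_
    rw [covariance_comm, sq]
  have hVW : MemLp (fun ω => V ω - ∑ k, a k * Q.std i k ω) 2 Q.Pr := hV.sub hW
  rw [← covariance_self hVW.1.aemeasurable, covariance_fun_sub_fun_sub hV hW hV hW,
    covariance_sum_std_sum_std, P_self, Matrix.one_mulVec, hself,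
    covariance_comm V (fun ω => ∑ k, a k * Q.std i k ω),
    hself] at h
  simp only [dotProduct, ← sq] at h
  linarith

/-- The regression of `V` on the signal of agent `i` leaves a residual that is uncorrelated with,
hence (the variables being jointly Gaussian) independent of this signal. -/
theorem condExp_of_mem_gaussianSpan {V : Q.Ω → ℝ} (hV : V ∈ Q.gaussianSpan) (i : unitInterval) :
    Q.Pr[V | MeasurableSpace.comap (Q.S i) inferInstance] =ᵐ[Q.Pr] fun ω =>
      ∫ ω', V ω' ∂Q.Pr + ∑ k, cov[V, Q.std i k; Q.Pr] * Q.std i k ω := by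
  set a : Fin d → ℝ := fun k => cov[V, Q.std i k; Q.Pr] with ha
  have hV2 := memLp_of_mem_gaussianSpan hV
  have hW := memLp_sum_std (Q := Q) i a
  set c : ℝ := ∑ k, a k * ∑ l, invSqrt (Q.K i i) k l * Q.m i l with hc
  set R : Q.Ω → ℝ := fun ω => V ω - ∑ k, a k * Q.std i k ω with hR
  have hR2 : MemLp R 2 Q.Pr := hV2.sub hW
  have hRstd : ∀ l, cov[R, Q.std i l; Q.Pr] = 0 := fun l => by
    rw [hR, covariance_fun_sub_left hV2 hW (Q.memLp_std i l), covariance_sum_std_std, P_self,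
      Matrix.one_mulVec, sub_self]
  have hRS : ∀ k, cov[R, fun ω => Q.S i ω k; Q.Pr] = 0 := fun k => by
    have h : (fun ω => Q.S i ω k) = fun ω =>
        Q.m i k + ∑ l, (Q.K i i * invSqrt (Q.K i i)) k l * Q.std i l ω := by
      ext ω
      exact congrFun (Q.S_eq i ω) k
    rw [h, covariance_const_add_right ((memLp_sum_std i _).integrable one_le_two),
      covariance_comm, covariance_sum_std_left hR2]
    exact Finset.sum_eq_zero fun l _ => by rw [covariance_comm, hRstd, mul_zero]
  have hspan : (fun ω => R ω - c) ∈ Q.gaussianSpan := by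
    have h : (fun ω => R ω - c) =
        V - ∑ k, a k • ∑ l, invSqrt (Q.K i i) k l • fun ω => Q.S i ω l := by
      ext ω
      simp only [hR, hc, std_eq, Pi.sub_apply, Finset.sum_apply, Pi.smul_apply, smul_eq_mul,
        mul_sub, Finset.sum_sub_distrib]
      ring
    rw [h]
    exact sub_mem hV (sum_mem fun k _ => Submodule.smul_mem _ _
      (sum_mem fun l _ => Submodule.smul_mem _ _ (S_mem_gaussianSpan i l)))
  have hindep : IndepFun (fun ω (_ : Unit) => R ω - c) (Q.S i) Q.Pr := by
    refine IsGaussianProcess.indepFun_of_covariance_eq_zero (X := fun (_ : Unit) ω => R ω - c)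
      (Y := fun k ω => Q.S i ω k) (Q.gaussian.of_mem_span ?_)
      (fun _ => (hR2.sub (memLp_const c)).1.aemeasurable)
      (fun k => (Q.memLp_S i k).1.aemeasurable) fun _ k => ?_
    · rintro (_ | k)
      exacts [hspan, S_mem_gaussianSpan i k]
    · rw [covariance_sub_const_left (hR2.integrable one_le_two), hRS]
  have hindep' : IndepFun R (Q.S i) Q.Pr := by
    have := hindep.comp (φ := fun x : Unit → ℝ => x () + c) (ψ := id) (by fun_prop) measurable_id
    simpa [Function.comp_def] using this
  have hle : MeasurableSpace.comap (Q.S i) inferInstance ≤ Q.mΩ := (Q.measurable_S i).comap_le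
  have hWm : StronglyMeasurable[MeasurableSpace.comap (Q.S i) inferInstance]
      (fun ω => ∑ k, a k * Q.std i k ω) := by
    have h : Measurable fun s : Fin d → ℝ =>
        ∑ k, a k * (invSqrt (Q.K i i)).mulVec (s - Q.m i) k := by
      unfold Matrix.mulVec dotProduct
      fun_prop
    exact (h.comp (comap_measurable (Q.S i))).stronglyMeasurable
  have hsum : V = R + fun ω => ∑ k, a k * Q.std i k ω := by ext ω; simp [hR]
  have hcR : Q.Pr[R | MeasurableSpace.comap (Q.S i) inferInstance] =ᵐ[Q.Pr]
      fun _ => ∫ ω', R ω' ∂Q.Pr := by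
    have hRm : Measurable R := (measurable_of_mem_gaussianSpan hV).sub
      (Finset.measurable_sum _ fun k _ => (Q.measurable_std i k).const_mul _)
    exact condExp_indep_eq hRm.comap_le hle (comap_measurable R).stronglyMeasurable hindep'
  have hRint : ∫ ω', R ω' ∂Q.Pr = ∫ ω', V ω' ∂Q.Pr := by
    rw [hR, integral_sub (hV2.integrable one_le_two) (hW.integrable one_le_two),
      integral_sum_std, sub_zero]
  have hadd := condExp_add (hR2.integrable one_le_two) (hW.integrable one_le_two)
    (MeasurableSpace.comap (Q.S i) inferInstance)
  rw [condExp_of_stronglyMeasurable hle hWm (hW.integrable one_le_two), ← hsum] at hadd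
  filter_upwards [hadd, hcR] with ω h1 h2
  rw [h1, Pi.add_apply, h2, hRint]

end SignalProcess

/-! ### Existence of Pettis integrals -/

theorem inner_toLp_eq_integral {Ω : Type*} [MeasurableSpace Ω] {Pr : Measure Ω} {f g : Ω → ℝ}
    (hf : MemLp f 2 Pr) (hg : MemLp g 2 Pr) :
    inner ℝ (hf.toLp f) (hg.toLp g) = ∫ ω, f ω * g ω ∂Pr := by
  rw [L2.inner_def]
  refine integral_congr_ae ?_
  filter_upwards [hf.coeFn_toLp, hg.coeFn_toLp] with ω h1 h2
  rw [h1, h2, real_inner_eq_re_inner, RCLike.inner_apply, RCLike.conj_to_real, mul_comm]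
  rfl

/-- A function into a real Hilbert space whose inner products with its own values are measurable
is weakly measurable: the vectors with measurable inner products form a closed subspace, which
contains the values of the function and their orthogonal complement. -/
theorem measurable_inner_of_measurable_inner_range {ι H : Type*} [MeasurableSpace ι]
    [NormedAddCommGroup H] [InnerProductSpace ℝ H] [CompleteSpace H] {F : ι → H}
    (hF : ∀ k, Measurable fun j => inner ℝ (F j) (F k)) (Z : H) :
    Measurable fun j => inner ℝ (F j) Z := by
  let M : Submodule ℝ H :=
    { carrier := {Z | Measurable fun j => inner ℝ (F j) Z}
      add_mem' := fun {a b} ha hb => by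
        simp only [mem_ofPred_eq, inner_add_right] at *
        exact ha.add hb
      zero_mem' := by simp
      smul_mem' := fun c a ha => by
        simp only [mem_ofPred_eq, inner_smul_right] at *
        exact ha.const_mul c }
  have hM : IsClosed (M : Set H) := by
    refine IsSeqClosed.isClosed fun f g hf hfg => ?_
    refine measurable_of_tendsto_metrizable (f := fun n j => inner ℝ (F j) (f n)) hf ?_
    exact tendsto_pi_nhds.2 fun j => tendsto_const_nhds.inner hfg
  set K : Submodule ℝ H := (Submodule.span ℝ (range F)).topologicalClosure with hK
  have hKM : K ≤ M := Submodule.topologicalClosure_minimal _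
    (Submodule.span_le.2 (by rintro _ ⟨k, rfl⟩; exact hF k)) hM
  have hFK : ∀ j, F j ∈ K := fun j =>
    Submodule.le_topologicalClosure _ (Submodule.subset_span (mem_range_self j))
  obtain ⟨y, hy, z, hz, rfl⟩ := K.exists_add_mem_mem_orthogonal Z
  have : ∀ j, inner ℝ (F j) z = 0 := fun j => (Submodule.mem_orthogonal K z).1 hz _ (hFK j)
  simp only [inner_add_right, this, add_zero]
  exact hKM hy

/-- Weighted Pettis integrals exist for square integrable weights, by the Riesz representation
theorem. -/
theorem exists_isPettisIntegral {Ω : Type u} [MeasurableSpace Ω] {Pr : Measure Ω}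
    {f : unitInterval → Ω → ℝ} (hf : ∀ j, MemLp (f j) 2 Pr)
    (hm : ∀ k, Measurable fun j => ∫ ω, f j ω * f k ω ∂Pr)
    (hint : Integrable (fun j => ∫ ω, |f j ω| ^ 2 ∂Pr) volume)
    {w : unitInterval → ℝ} (hw : MemLp w 2 volume) :
    ∃ Y, IsPettisIntegral Pr (fun j ω => w j * f j ω) Y := by
  set F : unitInterval → Lp ℝ 2 Pr := fun j => (hf j).toLp (f j) with hF
  have hFF : ∀ j k, inner ℝ (F j) (F k) = ∫ ω, f j ω * f k ω ∂Pr := fun j k =>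
    inner_toLp_eq_integral (hf j) (hf k)
  have hmeas : ∀ Z, Measurable fun j => inner ℝ (F j) Z :=
    measurable_inner_of_measurable_inner_range (by simpa only [hFF] using hm)
  have hnsq : ∀ j, ‖F j‖ ^ 2 = ∫ ω, |f j ω| ^ 2 ∂Pr := fun j => by
    rw [← real_inner_self_eq_norm_sq, hFF]
    simp only [sq, abs_mul_abs_self]
  have hnorm : MemLp (fun j => ‖F j‖) 2 volume := by
    have hmn : AEStronglyMeasurable (fun j => ‖F j‖) volume := by
      have : (fun j => ‖F j‖) = fun j => √(∫ ω, |f j ω| ^ 2 ∂Pr) := by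
        ext j; rw [← hnsq, Real.sqrt_sq (norm_nonneg _)]
      rw [this]
      exact Real.continuous_sqrt.comp_aestronglyMeasurable hint.1
    rw [memLp_two_iff_integrable_sq hmn]
    simpa only [hnsq] using hint
  have hinner : ∀ Z, MemLp (fun j => inner ℝ (F j) Z) 2 volume := fun Z =>
    hnorm.of_le_mul (c := ‖Z‖) (hmeas Z).aestronglyMeasurable
      (ae_of_all _ fun j => by
        rw [norm_norm, mul_comm]
        exact norm_inner_le_norm _ _)
  have hwint : ∀ Z, Integrable (fun j => w j * inner ℝ (F j) Z) volume := fun Z =>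
    hw.integrable_mul (hinner Z)
  let Λ : Lp ℝ 2 Pr →L[ℝ] ℝ := LinearMap.mkContinuous
    { toFun := fun Z => ∫ j, w j * inner ℝ (F j) Z
      map_add' := fun Y Z => by
        simp only [inner_add_right, mul_add]
        exact integral_add (hwint Y) (hwint Z)
      map_smul' := fun c Z => by
        simp only [inner_smul_right, RingHom.id_apply, smul_eq_mul]
        rw [← integral_const_mul]
        congr 1 with j
        ring }
    (∫ j, ‖w j‖ * ‖F j‖) fun Z => by
      rw [LinearMap.coe_mk, AddHom.coe_mk, ← integral_mul_const]
      refine norm_integral_le_of_norm_le ((hw.norm.integrable_mul hnorm).mul_const _)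
        (ae_of_all _ fun j => ?_)
      rw [norm_mul, mul_assoc]
      gcongr
      exact norm_inner_le_norm _ _
  set Y := (InnerProductSpace.toDual ℝ (Lp ℝ 2 Pr)).symm Λ with hY
  refine ⟨Y, Lp.memLp Y, fun j => (hf j).const_mul _, fun Z hZ => ?_⟩
  have hpair : ∀ j, ∫ ω, w j * f j ω * Z ω ∂Pr = w j * inner ℝ (F j) (hZ.toLp Z) := fun j => by
    rw [hF, inner_toLp_eq_integral (hf j) hZ, ← integral_const_mul]
    simp only [mul_assoc]
  simp only [hpair]
  refine ⟨hwint _, ?_⟩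
  have h := inner_toLp_eq_integral (Lp.memLp Y) hZ
  rw [Lp.toLp_coeFn, hY, InnerProductSpace.toDual_symm_apply] at h
  exact h.symm

/-! ### Affine actions -/

/-- The block matrix `diag(1, A)`. -/
def withIntercept {d : ℕ} (A : Matrix (Fin d) (Fin d) ℝ) :
    Matrix (Fin (d + 1)) (Fin (d + 1)) ℝ :=
  Matrix.of (Fin.cons (Fin.cons 1 0) fun k => Fin.cons 0 (A k))

section WithIntercept

variable {d : ℕ} (A B : Matrix (Fin d) (Fin d) ℝ) (v : EuclideanSpace ℝ (Fin (d + 1)))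

theorem toEuclideanCLM_withIntercept_zero :
    Matrix.toEuclideanCLM (𝕜 := ℝ) (withIntercept A) v 0 = v 0 := by
  rw [Matrix.ofLp_toEuclideanCLM]
  simp [withIntercept, Matrix.mulVec, dotProduct, Fin.sum_univ_succ]

theorem toEuclideanCLM_withIntercept_succ (k : Fin d) :
    Matrix.toEuclideanCLM (𝕜 := ℝ) (withIntercept A) v k.succ =
      A.mulVec (fun l => v l.succ) k := by
  rw [Matrix.ofLp_toEuclideanCLM]
  simp [withIntercept, Matrix.mulVec, dotProduct, Fin.sum_univ_succ]

theorem norm_toEuclideanCLM_withIntercept_le (hA : ‖Matrix.toEuclideanCLM (𝕜 := ℝ) A‖ ≤ 1) :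
    ‖Matrix.toEuclideanCLM (𝕜 := ℝ) (withIntercept A)‖ ≤ 1 := by
  refine ContinuousLinearMap.opNorm_le_bound _ zero_le_one fun v => ?_
  rw [one_mul, ← sq_le_sq₀ (norm_nonneg _) (norm_nonneg _), EuclideanSpace.norm_sq_eq,
    EuclideanSpace.norm_sq_eq, Fin.sum_univ_succ, Fin.sum_univ_succ (n := d)]
  simp only [toEuclideanCLM_withIntercept_zero, toEuclideanCLM_withIntercept_succ]
  have h := (Matrix.toEuclideanCLM (𝕜 := ℝ) A).le_of_opNorm_le hA
    (WithLp.toLp 2 fun l => v l.succ)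
  rw [one_mul, ← sq_le_sq₀ (norm_nonneg _) (norm_nonneg _), EuclideanSpace.norm_sq_eq,
    EuclideanSpace.norm_sq_eq] at h
  simp only [Matrix.ofLp_toEuclideanCLM] at h
  linarith

theorem norm_toEuclideanCLM_withIntercept_sub_le :
    ‖Matrix.toEuclideanCLM (𝕜 := ℝ) (withIntercept A) -
      Matrix.toEuclideanCLM (𝕜 := ℝ) (withIntercept B)‖ ≤
      ‖Matrix.toEuclideanCLM (𝕜 := ℝ) (A - B)‖ := by
  refine ContinuousLinearMap.opNorm_le_bound _ (norm_nonneg _) fun v => ?_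
  have h := (Matrix.toEuclideanCLM (𝕜 := ℝ) (A - B)).le_opNorm (WithLp.toLp 2 fun l => v l.succ)
  have h2 : ‖(Matrix.toEuclideanCLM (𝕜 := ℝ) (withIntercept A) -
      Matrix.toEuclideanCLM (𝕜 := ℝ) (withIntercept B)) v‖ =
      ‖Matrix.toEuclideanCLM (𝕜 := ℝ) (A - B) (WithLp.toLp 2 fun l => v l.succ)‖ := by
    rw [← sq_eq_sq₀ (norm_nonneg _) (norm_nonneg _), EuclideanSpace.norm_sq_eq,
      EuclideanSpace.norm_sq_eq, Fin.sum_univ_succ]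
    simp [toEuclideanCLM_withIntercept_zero, toEuclideanCLM_withIntercept_succ]
  have h3 : ‖(WithLp.toLp 2 fun l => v l.succ : EuclideanSpace ℝ (Fin d))‖ ≤ ‖v‖ := by
    rw [← sq_le_sq₀ (norm_nonneg _) (norm_nonneg _), EuclideanSpace.norm_sq_eq,
      EuclideanSpace.norm_sq_eq, Fin.sum_univ_succ (n := d)]
    exact le_add_of_nonneg_left (sq_nonneg _)
  rw [h2]
  exact h.trans (by gcongr)

end WithIntercept

namespace SignalProcess

variable {d : ℕ} {μθ σθ : ℝ} (Q : SignalProcess.{u} d μθ σθ)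

/-- The random action of agent `i` under the affine strategy with coefficients `v`, where
`v 0` is the intercept. -/
noncomputable def affine (i : unitInterval) (v : EuclideanSpace ℝ (Fin (d + 1))) (ω : Q.Ω) : ℝ :=
  v 0 + ∑ k : Fin d, v k.succ * Q.std i k ω

/-- The operator on coefficients induced by conditioning an action of agent `j` on the signal of
agent `i`. -/
noncomputable def condOp (i j : unitInterval) :
    EuclideanSpace ℝ (Fin (d + 1)) →L[ℝ] EuclideanSpace ℝ (Fin (d + 1)) :=
  Matrix.toEuclideanCLM (𝕜 := ℝ) (withIntercept (Q.P i j))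

/-- The coefficients of the conditional expectation of the state. -/
noncomputable def stateCoeff (i : unitInterval) : EuclideanSpace ℝ (Fin (d + 1)) :=
  WithLp.toLp 2 (Fin.cons μθ (σθ • Q.Pθ i))

theorem integral_θ : ∫ ω, Q.θ ω ∂Q.Pr = μθ := by
  have h := integral_map Q.measurable_θ.aemeasurable (f := fun x : ℝ => x)
    (μ := Q.Pr) (by fun_prop)
  rw [Q.θ_law, integral_id_gaussianReal] at h
  exact h.symm

theorem covariance_θ_θ : cov[Q.θ, Q.θ; Q.Pr] = σθ ^ 2 := by
  have h := variance_map (μ := Q.Pr) (X := id) (Y := Q.θ) (by fun_prop)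
    Q.measurable_θ.aemeasurable
  rw [Q.θ_law, variance_id_gaussianReal, Real.coe_toNNReal _ (sq_nonneg _)] at h
  rw [covariance_self Q.measurable_θ.aemeasurable, h]
  rfl

theorem norm_toEuclideanCLM_P_le (i j : unitInterval) :
    ‖Matrix.toEuclideanCLM (𝕜 := ℝ) (Q.P i j)‖ ≤ 1 := by
  refine ContinuousLinearMap.opNorm_le_bound _ zero_le_one fun v => ?_
  rw [one_mul, ← sq_le_sq₀ (norm_nonneg _) (norm_nonneg _), EuclideanSpace.norm_sq_eq,
    EuclideanSpace.norm_sq_eq]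
  have h := sum_covariance_std_sq_le (memLp_sum_std (Q := Q) j v) i
  simp only [covariance_sum_std_std] at h
  rw [covariance_sum_std_sum_std, P_self, Matrix.one_mulVec] at h
  simpa [Matrix.ofLp_toEuclideanCLM, dotProduct, ← sq] using h

theorem norm_condOp_le (i j : unitInterval) : ‖Q.condOp i j‖ ≤ 1 :=
  norm_toEuclideanCLM_withIntercept_le _ (Q.norm_toEuclideanCLM_P_le i j)

theorem norm_Pθ_le (hσ : 0 < σθ) (i : unitInterval) :
    ‖(WithLp.toLp 2 (Q.Pθ i) : EuclideanSpace ℝ (Fin d))‖ ≤ 1 := by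
  have h := sum_covariance_std_sq_le Q.memLp_θ i
  have h2 : ∀ k, cov[Q.θ, Q.std i k; Q.Pr] = σθ * Q.Pθ i k := fun k => by
    rw [covariance_comm, Q.covariance_std_θ hσ]
  simp only [h2, mul_pow, covariance_θ_θ, ← Finset.mul_sum] at h
  rw [← sq_le_sq₀ (norm_nonneg _) zero_le_one, EuclideanSpace.norm_sq_eq]
  simp only [Real.norm_eq_abs, sq_abs]
  nlinarith [pow_pos hσ 2]

theorem affine_add (i : unitInterval) (v w : EuclideanSpace ℝ (Fin (d + 1))) :
    Q.affine i (v + w) = Q.affine i v + Q.affine i w := by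
  ext ω
  simp only [affine, PiLp.add_apply, Pi.add_apply, add_mul, Finset.sum_add_distrib]
  ring

theorem affine_smul (i : unitInterval) (a : ℝ) (v : EuclideanSpace ℝ (Fin (d + 1))) :
    Q.affine i (a • v) = a • Q.affine i v := by
  ext ω
  simp only [affine, PiLp.smul_apply, Pi.smul_apply, smul_eq_mul, mul_add, Finset.mul_sum,
    mul_assoc]

theorem memLp_affine (i : unitInterval) (v : EuclideanSpace ℝ (Fin (d + 1))) :
    MemLp (Q.affine i v) 2 Q.Pr :=
  (memLp_const (v 0)).add (memLp_sum_std i fun k => v k.succ)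

theorem stronglyMeasurable_affine (i : unitInterval) (v : EuclideanSpace ℝ (Fin (d + 1))) :
    StronglyMeasurable[MeasurableSpace.comap (Q.S i) inferInstance] (Q.affine i v) := by
  have h : Measurable fun s : Fin d → ℝ =>
      v 0 + ∑ k : Fin d, v k.succ * (invSqrt (Q.K i i)).mulVec (s - Q.m i) k := by
    unfold Matrix.mulVec dotProduct
    fun_prop
  exact (h.comp (comap_measurable (Q.S i))).stronglyMeasurable

theorem integrable_affine (i : unitInterval) (v : EuclideanSpace ℝ (Fin (d + 1))) :
    Integrable (Q.affine i v) Q.Pr :=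
  (Q.memLp_affine i v).integrable one_le_two

theorem integral_affine (i : unitInterval) (v : EuclideanSpace ℝ (Fin (d + 1))) :
    ∫ ω, Q.affine i v ω ∂Q.Pr = v 0 := by
  simp only [affine]
  rw [integral_add (integrable_const _) ((memLp_sum_std i _).integrable one_le_two),
    integral_sum_std]
  simp

theorem integral_affine_mul_affine (i j : unitInterval) (u v : EuclideanSpace ℝ (Fin (d + 1))) :
    ∫ ω, Q.affine i u ω * Q.affine j v ω ∂Q.Pr =
      u 0 * v 0 + (fun k : Fin d => u k.succ) ⬝ᵥ (Q.P i j).mulVec fun l => v l.succ := by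
  have h := covariance_eq_sub (Q.memLp_affine i u) (Q.memLp_affine j v)
  rw [integral_affine, integral_affine] at h
  have h2 : cov[Q.affine i u, Q.affine j v; Q.Pr] =
      (fun k : Fin d => u k.succ) ⬝ᵥ (Q.P i j).mulVec fun l => v l.succ := by
    unfold affine
    rw [covariance_const_add_left ((memLp_sum_std i _).integrable one_le_two),
      covariance_const_add_right ((memLp_sum_std j _).integrable one_le_two),
      covariance_sum_std_sum_std]
  rw [h2] at h
  rw [h]
  simp

theorem integral_affine_sq (i : unitInterval) (v : EuclideanSpace ℝ (Fin (d + 1))) :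
    ∫ ω, Q.affine i v ω ^ 2 ∂Q.Pr = ‖v‖ ^ 2 := by
  simp only [sq (Q.affine i v _)]
  rw [integral_affine_mul_affine, P_self, Matrix.one_mulVec, EuclideanSpace.norm_sq_eq,
    Fin.sum_univ_succ]
  simp [dotProduct, sq]

/-- The components of a standardized signal are linearly independent modulo constants. -/
theorem affine_ae_eq_iff {i : unitInterval} {v w : EuclideanSpace ℝ (Fin (d + 1))} :
    Q.affine i v =ᵐ[Q.Pr] Q.affine i w ↔ v = w := by
  refine ⟨fun h => ?_, fun h => h ▸ EventuallyEq.rfl⟩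
  have h2 := Q.integral_affine_sq i (v - w)
  rw [integral_eq_zero_of_ae] at h2
  · exact sub_eq_zero.1 (norm_eq_zero.1 (by nlinarith))
  · filter_upwards [h] with ω hω
    have h3 := congrFun (Q.affine_add i (v - w) w) ω
    rw [sub_add_cancel, Pi.add_apply, hω] at h3
    simp only [Pi.zero_apply, ne_eq, OfNat.ofNat_ne_zero, not_false_eq_true, pow_eq_zero_iff]
    linarith

theorem condExp_θ (hσ : 0 < σθ) (i : unitInterval) :
    Q.Pr[Q.θ | MeasurableSpace.comap (Q.S i) inferInstance] =ᵐ[Q.Pr]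
      Q.affine i (Q.stateCoeff i) := by
  filter_upwards [condExp_of_mem_gaussianSpan (Q := Q) θ_mem_gaussianSpan i] with ω h
  rw [h, integral_θ, affine]
  congr 1
  refine Finset.sum_congr rfl fun k _ => ?_
  rw [covariance_comm, Q.covariance_std_θ hσ]
  rfl

theorem condExp_affine (i j : unitInterval) (v : EuclideanSpace ℝ (Fin (d + 1))) :
    Q.Pr[Q.affine j v | MeasurableSpace.comap (Q.S i) inferInstance] =ᵐ[Q.Pr]
      Q.affine i (Q.condOp i j v) := by
  set c : ℝ := v 0 - ∑ k : Fin d, v k.succ * ∑ l, invSqrt (Q.K j j) k l * Q.m j l with hc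
  set V : Q.Ω → ℝ := ∑ k : Fin d, v k.succ • ∑ l, invSqrt (Q.K j j) k l • fun ω => Q.S j ω l
    with hV
  have hVmem : V ∈ Q.gaussianSpan := sum_mem fun k _ => Submodule.smul_mem _ _
    (sum_mem fun l _ => Submodule.smul_mem _ _ (S_mem_gaussianSpan j l))
  have hsplit : Q.affine j v = V + fun _ => c := by
    ext ω
    simp only [affine, hV, hc, std_eq, Pi.add_apply, Finset.sum_apply, Pi.smul_apply, smul_eq_mul,
      mul_sub, Finset.sum_sub_distrib]
    ring
  have hVi := (memLp_of_mem_gaussianSpan hVmem).integrable one_le_two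
  have hle := (Q.measurable_S i).comap_le
  have hadd := condExp_add hVi (integrable_const c)
    (MeasurableSpace.comap (Q.S i) inferInstance)
  rw [condExp_const hle, ← hsplit] at hadd
  have hcov : ∀ k, cov[V, Q.std i k; Q.Pr] = (Q.P i j).mulVec (fun l => v l.succ) k := fun k => by
    rw [← covariance_sum_std_std, ← covariance_const_add_left
      ((memLp_sum_std j _).integrable one_le_two) (v 0)]
    change _ = cov[Q.affine j v, Q.std i k; Q.Pr]
    rw [hsplit]
    exact (covariance_add_const_left hVi c).symm
  have hint : ∫ ω, V ω ∂Q.Pr + c = v 0 := by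
    rw [← Q.integral_affine j v, hsplit]
    simp only [Pi.add_apply]
    rw [integral_add hVi (integrable_const c)]
    simp
  filter_upwards [hadd, condExp_of_mem_gaussianSpan hVmem i] with ω h1 h2
  rw [h1, Pi.add_apply, h2, affine, condOp, toEuclideanCLM_withIntercept_zero, ← hint]
  simp only [toEuclideanCLM_withIntercept_succ, hcov]
  ring

end SignalProcess

/-! ### Best responses and the equilibrium equation -/

theorem Matrix.stronglyMeasurable_toEuclideanCLM {ι n : Type*} [MeasurableSpace ι] [Fintype n]
    [DecidableEq n] {A : ι → Matrix n n ℝ} (hA : ∀ k l, Measurable fun i => A i k l) :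
    StronglyMeasurable fun i => Matrix.toEuclideanCLM (𝕜 := ℝ) (A i) := by
  have h : ∀ i, Matrix.toEuclideanCLM (𝕜 := ℝ) (A i) =
      ∑ k, ∑ l, A i k l • Matrix.toEuclideanCLM (𝕜 := ℝ) (Matrix.single k l (1 : ℝ)) := by
    intro i
    conv_lhs => rw [Matrix.matrix_eq_sum_single (A i)]
    simp only [map_sum, ← map_smul, Matrix.smul_single, smul_eq_mul, mul_one]
  simp only [h]
  exact Finset.stronglyMeasurable_fun_sum _ fun k _ => Finset.stronglyMeasurable_fun_sum _ fun l _ =>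
    (hA k l).stronglyMeasurable.smul_const
      (Matrix.toEuclideanCLM (𝕜 := ℝ) (Matrix.single k l (1 : ℝ)))

namespace InfoStructure

variable {d : ℕ} {μθ σθ : ℝ} (Q : InfoStructure.{u} d μθ σθ)

theorem stronglyMeasurable_condOp :
    StronglyMeasurable fun p : unitInterval × unitInterval => Q.condOp p.1 p.2 := by
  refine Matrix.stronglyMeasurable_toEuclideanCLM fun k l => ?_
  cases k using Fin.cases <;> cases l using Fin.cases <;>
    simp [withIntercept, Q.measurable_P]

theorem measurable_stateCoeff : Measurable fun i => Q.stateCoeff i := by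
  refine (PiLp.continuous_toLp 2 fun _ : Fin (d + 1) => ℝ).measurable.comp ?_
  refine measurable_pi_iff.2 fun k => ?_
  cases k using Fin.cases
  · simp
  · simpa using (Q.measurable_Pθ _).const_mul σθ

theorem measurable_integral_affine_mul_affine
    {φ : unitInterval → EuclideanSpace ℝ (Fin (d + 1))} (hφ : Measurable φ) (j : unitInterval)
    (v : EuclideanSpace ℝ (Fin (d + 1))) :
    Measurable fun i => ∫ ω, Q.affine i (φ i) ω * Q.affine j v ω ∂Q.Pr := by
  have hc : ∀ k, Measurable fun i => φ i k := fun k =>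
    (measurable_pi_apply k).comp
      ((PiLp.continuous_ofLp 2 fun _ : Fin (d + 1) => ℝ).measurable.comp hφ)
  have hP : ∀ k l, Measurable fun i => Q.P i j k l := fun k l => by
    have h := (Q.measurable_P k l).comp (measurable_prodMk_right (y := j))
    exact h
  have hs : ∀ k : Fin d, Measurable fun i => ∑ l, Q.P i j k l * v l.succ := fun k =>
    Finset.measurable_sum _ fun l _ => (hP k l).mul_const _
  have hsum : Measurable fun i => ∑ k : Fin d, φ i k.succ * ∑ l, Q.P i j k l * v l.succ :=
    Finset.measurable_sum _ fun k _ => (hc k.succ).mul (hs k)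
  simp only [SignalProcess.integral_affine_mul_affine, dotProduct, Matrix.mulVec]
  exact ((hc 0).mul_const (v 0)).add hsum

end InfoStructure

namespace LQGGame

variable {d : ℕ} {μθ σθ : ℝ} (G : LQGGame.{u} d μθ σθ)

/-- The matrix-valued kernel `w(i,j) diag(1, P(i,j))` of the best-response operator. -/
noncomputable def kernel (p : unitInterval × unitInterval) :
    EuclideanSpace ℝ (Fin (d + 1)) →L[ℝ] EuclideanSpace ℝ (Fin (d + 1)) :=
  G.w p.1 p.2 • G.info.condOp p.1 p.2

/-- The coefficients of the optimal action of an agent whose local aggregate vanishes. -/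
noncomputable def drift (i : unitInterval) : EuclideanSpace ℝ (Fin (d + 1)) :=
  G.b i • G.info.stateCoeff i + EuclideanSpace.single 0 (G.c i)

theorem norm_kernel_le (p : unitInterval × unitInterval) : ‖G.kernel p‖ ≤ ‖G.w p.1 p.2‖ := by
  rw [kernel, norm_smul]
  exact mul_le_of_le_one_right (norm_nonneg _) (G.info.norm_condOp_le _ _)

theorem stronglyMeasurable_kernel : StronglyMeasurable G.kernel :=
  G.measurable_w.stronglyMeasurable.smul G.info.stronglyMeasurable_condOp

theorem memLp_kernel : MemLp G.kernel 2 (volume.prod volume) :=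
  G.memLp_w.of_le G.stronglyMeasurable_kernel.aestronglyMeasurable
    (ae_of_all _ fun p => G.norm_kernel_le p)

variable {G} in
theorem memLp_kernel_section {i : unitInterval} (hi : i ∈ G.agents) :
    MemLp (fun j => G.kernel (i, j)) 2 volume :=
  MemLp.of_le hi (G.stronglyMeasurable_kernel.comp_measurable
    measurable_prodMk_left).aestronglyMeasurable (ae_of_all _ fun j => G.norm_kernel_le (i, j))

theorem measurable_drift : Measurable G.drift := by
  refine (G.measurable_b.smul G.info.measurable_stateCoeff).add ?_
  refine (PiLp.continuous_toLp 2 fun _ : Fin (d + 1) => ℝ).measurable.comp ?_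
  refine measurable_pi_iff.2 fun k => ?_
  cases k using Fin.cases
  · simpa using G.measurable_c
  · simp

theorem norm_stateCoeff_le (Q : SignalProcess.{u} d μθ σθ) (hσ : 0 < σθ) (i : unitInterval) :
    ‖Q.stateCoeff i‖ ≤ |μθ| + σθ := by
  have h := Q.norm_Pθ_le hσ i
  rw [← sq_le_sq₀ (norm_nonneg _) zero_le_one, EuclideanSpace.norm_sq_eq] at h
  rw [← sq_le_sq₀ (norm_nonneg _) (by positivity), EuclideanSpace.norm_sq_eq, Fin.sum_univ_succ]
  simp only [Real.norm_eq_abs, sq_abs] at h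
  simp only [SignalProcess.stateCoeff, Fin.cons_zero, Fin.cons_succ, Pi.smul_apply, smul_eq_mul,
    Real.norm_eq_abs, sq_abs, mul_pow, ← Finset.mul_sum]
  nlinarith [abs_nonneg μθ, sq_abs μθ, pow_pos hσ 2, mul_nonneg (abs_nonneg μθ) hσ.le]

theorem memLp_drift (hσ : 0 < σθ) : MemLp G.drift 2 volume := by
  have h1 : MemLp (fun i => G.b i • G.info.stateCoeff i) 2 volume := by
    refine G.memLp_b.of_le_mul (c := |μθ| + σθ)
      (G.measurable_b.smul G.info.measurable_stateCoeff).aestronglyMeasurable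
      (ae_of_all _ fun i => ?_)
    rw [norm_smul, mul_comm]
    gcongr
    exact norm_stateCoeff_le _ hσ i
  have h2 : MemLp (fun i => (EuclideanSpace.single 0 (G.c i) : EuclideanSpace ℝ (Fin (d + 1)))) 2
      volume := by
    refine G.memLp_c.of_le ?_ (ae_of_all _ fun i => by rw [PiLp.norm_single])
    refine Measurable.aestronglyMeasurable ?_
    refine (PiLp.continuous_toLp 2 fun _ : Fin (d + 1) => ℝ).measurable.comp ?_
    refine measurable_pi_iff.2 fun k => ?_
    cases k using Fin.cases
    · simpa using G.measurable_c
    · simp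
  exact h1.add h2

theorem utility_eq (i : unitInterval) (x y t : ℝ) :
    G.utility i x y t = G.U i 0 0 * (x ^ 2 - 2 * x * (y + G.b i * t + G.c i)) +
      (G.U i 1 1 * y ^ 2 + 2 * G.U i 1 2 * (y * t) + 2 * G.U i 1 3 * y + G.U i 2 2 * t ^ 2 +
        2 * G.U i 2 3 * t + G.U i 3 3) := by
  have h0 := (G.U_neg i).ne
  have hs := fun k l => (G.U_symm i).apply k l
  have h1 : G.U i 0 1 = -G.U i 0 0 := by
    have := G.U_normalized i
    field_simp at this
    linarith
  have h2 : G.U i 0 2 = -(G.b i * G.U i 0 0) := by rw [G.b_eq]; field_simp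
  have h3 : G.U i 0 3 = -(G.c i * G.U i 0 0) := by rw [G.c_eq]; field_simp
  simp only [utility, dotProduct, Matrix.mulVec, Fin.sum_univ_four, Matrix.cons_val]
  rw [hs 0 1, hs 0 2, hs 0 3, hs 1 2, hs 1 3, hs 2 3, h1, h2, h3]
  ring

theorem isMaxOn_integral_utility_iff {κ : Measure (ℝ × ℝ)} [IsProbabilityMeasure κ]
    (hy : MemLp Prod.fst 2 κ) (ht : MemLp Prod.snd 2 κ) (i : unitInterval) (x : ℝ) :
    IsMaxOn (fun x => ∫ p, G.utility i x p.1 p.2 ∂κ) univ x ↔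
      x = ∫ p, p.1 ∂κ + G.b i * ∫ p, p.2 ∂κ + G.c i := by
  set M := ∫ p, p.1 ∂κ + G.b i * ∫ p, p.2 ∂κ + G.c i with hM
  have iy := hy.integrable one_le_two
  have it := ht.integrable one_le_two
  set H : ℝ × ℝ → ℝ := fun p => G.U i 1 1 * p.1 ^ 2 + 2 * G.U i 1 2 * (p.1 * p.2) +
    2 * G.U i 1 3 * p.1 + G.U i 2 2 * p.2 ^ 2 + 2 * G.U i 2 3 * p.2 + G.U i 3 3 with hH
  have iH : Integrable H κ :=
    (((((hy.integrable_sq.const_mul _).add ((hy.integrable_mul ht).const_mul _)).add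
      (iy.const_mul _)).add (ht.integrable_sq.const_mul _)).add (it.const_mul _)).add
      (integrable_const _)
  have iA : Integrable (fun p : ℝ × ℝ => p.1 + G.b i * p.2) κ := iy.add (it.const_mul _)
  have hA : ∫ p, p.1 + G.b i * p.2 + G.c i ∂κ = M := by
    rw [integral_add iA (integrable_const _), integral_add iy (it.const_mul _),
      integral_const_mul]
    simp [hM]
  have hval : ∀ z, ∫ p, G.utility i z p.1 p.2 ∂κ =
      G.U i 0 0 * (z ^ 2 - 2 * z * M) + ∫ p, H p ∂κ := fun z => by
    have iA' : Integrable (fun p : ℝ × ℝ => 2 * z * (p.1 + G.b i * p.2 + G.c i)) κ :=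
      (iA.add (integrable_const (G.c i))).const_mul (2 * z)
    have iB : Integrable (fun p : ℝ × ℝ =>
        G.U i 0 0 * (z ^ 2 - 2 * z * (p.1 + G.b i * p.2 + G.c i))) κ :=
      ((integrable_const _).sub iA').const_mul _
    simp only [utility_eq]
    rw [integral_add iB iH, integral_const_mul,
      integral_sub (integrable_const _) iA', integral_const_mul, hA]
    simp
  have hU := G.U_neg i
  simp only [isMaxOn_univ_iff, hval, add_le_add_iff_right]
  constructor
  · intro h
    have h1 := h M
    have h2 : (x - M) ^ 2 ≤ 0 := by nlinarith
    exact sub_eq_zero.1 (pow_eq_zero_iff two_ne_zero |>.1 (le_antisymm h2 (sq_nonneg _)))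
  · rintro rfl z
    nlinarith [sq_nonneg (z - M)]

/-- The first-order condition: an action rule is optimal iff it is the conditional expectation of
the ideal action `Y + b θ + c`. -/
theorem ae_isMaxOn_condUtility_iff {i : unitInterval} {Y : G.info.Ω → ℝ}
    (hY : MemLp Y 2 G.info.Pr) {x : (Fin d → ℝ) → ℝ} (hx : Measurable x) :
    (∀ᵐ s ∂(G.info.Pr.map (G.info.S i)), IsMaxOn (G.condUtility i Y s) univ (x s)) ↔
      (fun ω => x (G.info.S i ω)) =ᵐ[G.info.Pr] fun ω =>
        (G.info.Pr[Y | MeasurableSpace.comap (G.info.S i) inferInstance]) ω +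
        G.b i * (G.info.Pr[G.info.θ | MeasurableSpace.comap (G.info.S i) inferInstance]) ω +
        G.c i := by
  have hS := G.info.measurable_S i
  have hθ := G.info.memLp_θ
  have hYθ : AEMeasurable (fun ω => (Y ω, G.info.θ ω)) G.info.Pr :=
    hY.1.aemeasurable.prodMk hθ.1.aemeasurable
  set κ := condDistrib (fun ω => (Y ω, G.info.θ ω)) (G.info.S i) G.info.Pr with hκ
  have hjoint : AEMeasurable (fun ω => (G.info.S i ω, (Y ω, G.info.θ ω))) G.info.Pr :=
    hS.aemeasurable.prodMk hYθ
  have hy : ∀ᵐ s ∂(G.info.Pr.map (G.info.S i)), MemLp Prod.fst 2 (κ s) := by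
    have h : Integrable (fun q : (Fin d → ℝ) × (ℝ × ℝ) => q.2.1 ^ 2)
        (G.info.Pr.map fun ω => (G.info.S i ω, (Y ω, G.info.θ ω))) :=
      (integrable_map_measure (by fun_prop) hjoint).2 hY.integrable_sq
    filter_upwards [h.condDistrib_ae_map hYθ] with s hs
    exact (memLp_two_iff_integrable_sq (by fun_prop)).2 hs
  have ht : ∀ᵐ s ∂(G.info.Pr.map (G.info.S i)), MemLp Prod.snd 2 (κ s) := by
    have h : Integrable (fun q : (Fin d → ℝ) × (ℝ × ℝ) => q.2.2 ^ 2)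
        (G.info.Pr.map fun ω => (G.info.S i ω, (Y ω, G.info.θ ω))) :=
      (integrable_map_measure (by fun_prop) hjoint).2 hθ.integrable_sq
    filter_upwards [h.condDistrib_ae_map hYθ] with s hs
    exact (memLp_two_iff_integrable_sq (by fun_prop)).2 hs
  have hfoc : (∀ᵐ s ∂(G.info.Pr.map (G.info.S i)), IsMaxOn (G.condUtility i Y s) univ (x s)) ↔
      ∀ᵐ s ∂(G.info.Pr.map (G.info.S i)),
        x s = ∫ p, p.1 ∂(κ s) + G.b i * ∫ p, p.2 ∂(κ s) + G.c i := by
    refine eventually_congr ?_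
    filter_upwards [hy, ht] with s h1 h2
    exact G.isMaxOn_integral_utility_iff h1 h2 i (x s)
  have hm1 : StronglyMeasurable fun s => ∫ p, p.1 ∂(κ s) :=
    StronglyMeasurable.integral_condDistrib
      (f := fun q : (Fin d → ℝ) × (ℝ × ℝ) => q.2.1) (by fun_prop)
  have hm2 : StronglyMeasurable fun s => ∫ p, p.2 ∂(κ s) :=
    StronglyMeasurable.integral_condDistrib
      (f := fun q : (Fin d → ℝ) × (ℝ × ℝ) => q.2.2) (by fun_prop)
  have hm : Measurable fun s => ∫ p, p.1 ∂(κ s) + G.b i * ∫ p, p.2 ∂(κ s) + G.c i :=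
    (hm1.measurable.add (hm2.measurable.const_mul _)).add_const _
  rw [hfoc, ae_map_iff hS.aemeasurable (measurableSet_eq_fun hx hm)]
  have hc1 := condExp_ae_eq_integral_condDistrib hS hYθ (f := Prod.fst) (by fun_prop)
    (hY.integrable one_le_two)
  have hc2 := condExp_ae_eq_integral_condDistrib hS hYθ (f := Prod.snd) (by fun_prop)
    (hθ.integrable one_le_two)
  refine eventually_congr ?_
  filter_upwards [hc1, hc2] with ω h1 h2
  rw [h1, h2]

variable {G} {φ : unitInterval → EuclideanSpace ℝ (Fin (d + 1))}

theorem action_affineProfile (i : unitInterval) :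
    G.action (G.affineProfile φ) i = G.info.affine i (φ i) := rfl

theorem measurable_affineProfile (i : unitInterval) : Measurable (G.affineProfile φ i) := by
  unfold affineProfile Matrix.mulVec dotProduct
  fun_prop

theorem isStrategyProfile_affineProfile (hφ : Measurable φ) (hφ2 : MemLp φ 2 volume) :
    G.IsStrategyProfile (G.affineProfile φ) where
  measurable := measurable_affineProfile
  memLp i := G.info.memLp_affine i (φ i)
  measurable_moment j := G.info.measurable_integral_affine_mul_affine hφ j (φ j)
  integrable_moment := by
    simp only [action_affineProfile, sq_abs, SignalProcess.integral_affine_sq]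
    exact (memLp_two_iff_integrable_sq_norm hφ2.1).1 hφ2

/-- Conditioning a local aggregate on the signal of an agent amounts to applying the kernel
operator to the coefficients of the profile. -/
theorem condExp_of_isPettisIntegral {i : unitInterval} (hi : i ∈ G.agents)
    (hφ : MemLp φ 2 volume) {Y : G.info.Ω → ℝ}
    (hY : IsPettisIntegral G.info.Pr
      (fun j ω => G.w i j * G.action (G.affineProfile φ) j ω) Y) :
    G.info.Pr[Y | MeasurableSpace.comap (G.info.S i) inferInstance] =ᵐ[G.info.Pr]
      G.info.affine i (integralTransform volume G.kernel φ i) := by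
  obtain ⟨hY2, -, hpair⟩ := hY
  have hle := (G.info.measurable_S i).comap_le
  have hint : Integrable (fun j => G.kernel (i, j) (φ j)) volume :=
    integrable_clm_apply (memLp_kernel_section hi) hφ
  refine (ae_eq_condExp_of_forall_setIntegral_eq hle (hY2.integrable one_le_two)
    (fun s _ _ => (G.info.integrable_affine i _).integrableOn) (fun s hs _ => ?_)
    (G.info.stronglyMeasurable_affine i _).aestronglyMeasurable).symm
  have hs' : MeasurableSet[G.info.mΩ] s := hle s hs
  -- Integration over `s` is linear in the coefficients, so it commutes with the integral over `j`.
  let L : EuclideanSpace ℝ (Fin (d + 1)) →L[ℝ] ℝ := LinearMap.toContinuousLinearMap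
    { toFun := fun v => ∫ ω in s, G.info.affine i v ω ∂G.info.Pr
      map_add' := fun v w => by
        rw [SignalProcess.affine_add]
        exact integral_add (G.info.integrable_affine i v).integrableOn
          (G.info.integrable_affine i w).integrableOn
      map_smul' := fun a v => by
        rw [SignalProcess.affine_smul]
        exact integral_const_mul _ _ }
  have hsec : ∀ j, ∫ ω, G.w i j * G.action (G.affineProfile φ) j ω * s.indicator 1 ω ∂G.info.Pr =
      L (G.kernel (i, j) (φ j)) := by
    intro j
    have h1 : ∀ ω, G.w i j * G.action (G.affineProfile φ) j ω * s.indicator 1 ω =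
        G.w i j * s.indicator (G.info.affine j (φ j)) ω := fun ω => by
      rw [action_affineProfile]
      by_cases hω : ω ∈ s <;> simp [hω]
    simp only [h1]
    rw [integral_const_mul, integral_indicator hs', ← setIntegral_condExp hle
      (G.info.integrable_affine j (φ j)) hs, setIntegral_congr_ae hs'
        ((G.info.condExp_affine i j (φ j)).mono fun ω h _ => h)]
    change G.w i j * L (G.info.condOp i j (φ j)) = _
    rw [kernel, _root_.smul_apply, map_smul, smul_eq_mul]
  have h := (hpair (s.indicator 1) (memLp_indicator_const 2 hs' 1
    (Or.inr (measure_ne_top _ _)))).2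
  simp only [hsec] at h
  rw [L.integral_comp_comm hint] at h
  have h1 : ∀ ω, Y ω * s.indicator 1 ω = s.indicator Y ω := fun ω => by
    by_cases hω : ω ∈ s <;> simp [hω]
  simp only [h1] at h
  rw [integral_indicator hs'] at h
  exact h.symm

/-- Affine equilibria are the square integrable solutions of a linear integral equation. -/
theorem isAffineEquilibrium_iff (hσ : 0 < σθ) :
    G.IsAffineEquilibrium φ ↔ Measurable φ ∧ MemLp φ 2 volume ∧
      ∀ i ∈ G.agents, φ i = integralTransform volume G.kernel φ i + G.drift i := by
  refine and_congr_right fun hφ => and_congr_right fun hφ2 => ?_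
  have hX := isStrategyProfile_affineProfile (G := G) hφ hφ2
  have key : ∀ i ∈ G.agents, ∀ Y : G.info.Ω → ℝ, IsPettisIntegral G.info.Pr
      (fun j ω => G.w i j * G.action (G.affineProfile φ) j ω) Y →
      ((∀ᵐ s ∂(G.info.Pr.map (G.info.S i)),
        IsMaxOn (G.condUtility i Y s) univ (G.affineProfile φ i s)) ↔
      φ i = integralTransform volume G.kernel φ i + G.drift i) := by
    intro i hi Y hY
    rw [G.ae_isMaxOn_condUtility_iff hY.1 (measurable_affineProfile i),
      ← G.info.affine_ae_eq_iff (i := i)]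
    refine eventually_congr ?_
    filter_upwards [condExp_of_isPettisIntegral hi hφ2 hY, G.info.condExp_θ hσ i] with ω h1 h2
    rw [h1, h2, drift, SignalProcess.affine_add, SignalProcess.affine_add,
      SignalProcess.affine_smul]
    have h3 : G.info.affine i (EuclideanSpace.single 0 (G.c i)) ω = G.c i := by
      simp [SignalProcess.affine]
    rw [Pi.add_apply, Pi.add_apply, Pi.smul_apply, h3, smul_eq_mul, ← add_assoc]
    rfl
  constructor
  · rintro ⟨-, h⟩ i hi
    obtain ⟨Y, hY, hmax⟩ := h i hi
    exact (key i hi Y hY).1 hmax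
  · refine fun h => ⟨hX, fun i hi => ?_⟩
    obtain ⟨Y, hY⟩ := exists_isPettisIntegral hX.memLp (fun k => hX.measurable_moment k)
      hX.integrable_moment hi
    exact ⟨Y, hY, (key i hi Y hY).2 (h i hi)⟩

end LQGGame

/-! ### Uniqueness of equilibria and invertibility -/

namespace LQGGame

variable {d : ℕ} {μθ σθ : ℝ} (G : LQGGame.{u} d μθ σθ)

/-- The Hilbert–Schmidt operator of the equilibrium equation. -/
noncomputable def bestResponseOp :
    Lp (EuclideanSpace ℝ (Fin (d + 1))) 2 (volume : Measure unitInterval) →L[ℝ]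
      Lp (EuclideanSpace ℝ (Fin (d + 1))) 2 (volume : Measure unitInterval) :=
  kernelOp G.kernel G.memLp_kernel

/-- The inhomogeneous term of the equilibrium equation, as an element of `L²`. -/
noncomputable def driftLp (hσ : 0 < σθ) :
    Lp (EuclideanSpace ℝ (Fin (d + 1))) 2 (volume : Measure unitInterval) :=
  (G.memLp_drift hσ).toLp G.drift

theorem measurableSet_agents : MeasurableSet G.agents := by
  have hm : ∀ i, AEStronglyMeasurable (G.w i) volume := fun i =>
    (G.measurable_w.comp measurable_prodMk_left).aestronglyMeasurable
  have h : G.agents = {i | ∫⁻ j, ‖G.w i j‖ₑ ^ 2 < ∞} := by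
    ext i
    rw [mem_ofPred_eq, ← eLpNorm_two_sq, ENNReal.pow_lt_top_iff]
    simp [agents, MemLp, hm]
  rw [h]
  exact measurableSet_lt
    (Measurable.lintegral_prod_right' (f := fun p => ‖Function.uncurry G.w p‖ₑ ^ 2)
      (G.measurable_w.enorm.pow_const 2)) measurable_const

variable {G} {φ : unitInterval → EuclideanSpace ℝ (Fin (d + 1))}

theorem IsAffineEquilibrium.memLp (h : G.IsAffineEquilibrium φ) : MemLp φ 2 volume := h.2.1

theorem IsAffineEquilibrium.one_sub_bestResponseOp_apply (hσ : 0 < σθ)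
    (h : G.IsAffineEquilibrium φ) : (1 - G.bestResponseOp) (h.memLp.toLp φ) = G.driftLp hσ := by
  change h.memLp.toLp φ - G.bestResponseOp (h.memLp.toLp φ) = G.driftLp hσ
  rw [sub_eq_iff_eq_add']
  ext1
  filter_upwards [Lp.coeFn_add (G.bestResponseOp (h.memLp.toLp φ)) (G.driftLp hσ),
    coeFn_kernelOp G.memLp_kernel (h.memLp.toLp φ), (G.memLp_drift hσ).coeFn_toLp,
    h.memLp.coeFn_toLp, G.ae_mem_agents] with i h1 h2 h3 h4 hi
  rw [h1, Pi.add_apply, bestResponseOp, h2, driftLp, h3, h4,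
    integralTransform_congr h.memLp.coeFn_toLp]
  exact ((isAffineEquilibrium_iff hσ).1 h).2.2 i hi

/-- Every `L²` solution of the equilibrium equation has a representative that solves the equation
at each agent. -/
theorem exists_isAffineEquilibrium (hσ : 0 < σθ)
    {v : Lp (EuclideanSpace ℝ (Fin (d + 1))) 2 (volume : Measure unitInterval)}
    (hv : (1 - G.bestResponseOp) v = G.driftLp hσ) :
    ∃ ψ, G.IsAffineEquilibrium ψ ∧ ψ =ᵐ[volume] v := by
  set ψ : unitInterval → EuclideanSpace ℝ (Fin (d + 1)) :=
    G.agents.indicator fun i => integralTransform volume G.kernel v i + G.drift i with hψ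
  have hm : Measurable (integralTransform volume G.kernel v) := by
    have h := isBoundedBilinearMap_apply.continuous.comp_stronglyMeasurable
      (G.stronglyMeasurable_kernel.prodMk
        ((Lp.stronglyMeasurable v).comp_measurable measurable_snd))
    exact (StronglyMeasurable.integral_prod_right' (ν := (volume : Measure unitInterval))
      (f := fun p : unitInterval × unitInterval => G.kernel p (v p.2)) h).measurable
  have hψm : Measurable ψ := (hm.add G.measurable_drift).indicator G.measurableSet_agents
  have hψv : ψ =ᵐ[volume] v := by
    have hv' : v - G.bestResponseOp v = G.driftLp hσ := hv
    rw [sub_eq_iff_eq_add'] at hv'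
    have h1 : v =ᵐ[volume] ⇑(G.bestResponseOp v + G.driftLp hσ) := by rw [← hv']
    filter_upwards [h1, Lp.coeFn_add (G.bestResponseOp v) (G.driftLp hσ),
      coeFn_kernelOp G.memLp_kernel v, (G.memLp_drift hσ).coeFn_toLp,
      G.ae_mem_agents] with i h1 h2 h3 h4 hi
    rw [h1, h2, Pi.add_apply, bestResponseOp, h3, driftLp, h4, hψ, indicator_of_mem hi]
  refine ⟨ψ, (isAffineEquilibrium_iff hσ).2 ⟨hψm, (memLp_congr_ae hψv).2 (Lp.memLp v), ?_⟩, hψv⟩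
  intro i hi
  rw [integralTransform_congr hψv, hψ, indicator_of_mem hi]

theorem isCompactOperator_bestResponseOp : IsCompactOperator G.bestResponseOp :=
  isCompactOperator_kernelOp G.memLp_kernel

/-- A fixed vector `x` of the best-response operator can be added to an equilibrium, so uniqueness
forces `x = 0`, and the Fredholm alternative applies. -/
theorem HasUniqueAffineEquilibrium.isUnit (hσ : 0 < σθ) (h : G.HasUniqueAffineEquilibrium) :
    IsUnit (1 - G.bestResponseOp) := by
  obtain ⟨φ, hφ, huniq⟩ := h
  refine isCompactOperator_bestResponseOp.isUnit_one_sub fun x hx => ?_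
  have hsol : (1 - G.bestResponseOp) (hφ.memLp.toLp φ + x) = G.driftLp hσ := by
    rw [map_add, hφ.one_sub_bestResponseOp_apply hσ]
    change _ + (x - G.bestResponseOp x) = _
    rw [hx, sub_self, add_zero]
  obtain ⟨ψ, hψ, hψv⟩ := exists_isAffineEquilibrium hσ hsol
  have hψφ : ψ =ᵐ[volume] φ := by
    filter_upwards [G.ae_mem_agents] with i hi using huniq ψ hψ i hi
  have h : hφ.memLp.toLp φ + x = hφ.memLp.toLp φ := by
    ext1
    exact hψv.symm.trans (hψφ.trans hφ.memLp.coeFn_toLp.symm)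
  exact add_eq_left.1 h

theorem hasUniqueAffineEquilibrium_iff (hσ : 0 < σθ) :
    G.HasUniqueAffineEquilibrium ↔ IsUnit (1 - G.bestResponseOp) := by
  refine ⟨fun h => h.isUnit hσ, fun h => ?_⟩
  have hbij := (ContinuousLinearMap.isUnit_iff_bijective.1 h)
  obtain ⟨v, hv⟩ := hbij.2 (G.driftLp hσ)
  obtain ⟨ψ, hψ, -⟩ := exists_isAffineEquilibrium hσ hv
  refine ⟨ψ, hψ, fun χ hχ i hi => ?_⟩
  have heq : hχ.memLp.toLp χ = hψ.memLp.toLp ψ := hbij.1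
    ((hχ.one_sub_bestResponseOp_apply hσ).trans (hψ.one_sub_bestResponseOp_apply hσ).symm)
  rw [MemLp.toLp_eq_toLp_iff] at heq
  rw [((isAffineEquilibrium_iff hσ).1 hχ).2.2 i hi, ((isAffineEquilibrium_iff hσ).1 hψ).2.2 i hi,
    integralTransform_congr heq]

theorem IsUniqueAffineEquilibrium.toLp_eq (hσ : 0 < σθ) (h : G.IsUniqueAffineEquilibrium φ) :
    h.1.memLp.toLp φ = Ring.inverse (1 - G.bestResponseOp) (G.driftLp hσ) := by
  have hu := HasUniqueAffineEquilibrium.isUnit hσ ⟨φ, h⟩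
  rw [← h.1.one_sub_bestResponseOp_apply hσ, ← mul_apply_eq_comp,
    Ring.inverse_mul_cancel _ hu]
  rfl

end LQGGame

/-! ### Continuous dependence on the game -/

/-- Multiplication by a fixed `L²` function is continuous for the `L²` norm on uniformly bounded
functions, by truncating the `L²` function. -/
theorem tendsto_eLpNorm_mul_of_bounded {α ι : Type*} [MeasurableSpace α] {μ : Measure α}
    {l : Filter ι} {f : α → ℝ} (hf : MemLp f 2 μ) (hfm : StronglyMeasurable f) {C : ℝ}
    {g : ι → α → ℝ} (hgm : ∀ i, AEStronglyMeasurable (g i) μ) (hg : ∀ i x, ‖g i x‖ ≤ C)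
    (hlim : Tendsto (fun i => eLpNorm (g i) 2 μ) l (𝓝 0)) :
    Tendsto (fun i => eLpNorm (fun x => f x * g i x) 2 μ) l (𝓝 0) := by
  rw [ENNReal.tendsto_nhds_zero]
  intro ε hε
  obtain ⟨η, hη, hηε⟩ := ENNReal.exists_nnreal_pos_mul_lt
    (a := ‖C‖ₑ + 1) (by finiteness) hε.ne'
  obtain ⟨M, hM⟩ := hf.eLpNorm_indicator_norm_ge_le hfm (ε := η) (by exact_mod_cast hη)
  rw [ENNReal.ofReal_coe_nnreal] at hM
  have hMg : Tendsto (fun i => ‖M‖ₑ * eLpNorm (g i) 2 μ) l (𝓝 0) := by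
    simpa using ENNReal.Tendsto.const_mul hlim (Or.inr (enorm_ne_top (x := M)))
  have hηpos : (0 : ℝ≥0∞) < η := by exact_mod_cast hη
  filter_upwards [ENNReal.tendsto_nhds_zero.1 hMg η hηpos] with i hi
  set A : Set α := {x | M ≤ ‖f x‖₊} with hA
  have hAm : MeasurableSet A := measurableSet_le measurable_const (by fun_prop)
  have hpt : ∀ x, ‖f x * g i x‖ ≤ ‖C * A.indicator f x‖ + ‖M * g i x‖ := by
    intro x
    by_cases hx : x ∈ A
    · rw [indicator_of_mem hx, norm_mul, norm_mul C, mul_comm]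
      have := (hg i x).trans (Real.le_norm_self C)
      nlinarith [norm_nonneg (f x), norm_nonneg (M * g i x)]
    · have hx' : ‖f x‖ < M := not_le.1 hx
      rw [norm_mul, norm_mul M]
      have := hx'.le.trans (Real.le_norm_self M)
      nlinarith [norm_nonneg (g i x), norm_nonneg (C * A.indicator f x)]
  have hm1 : AEStronglyMeasurable (fun x => C * A.indicator f x) μ :=
    ((hfm.indicator hAm).const_mul C).aestronglyMeasurable
  have hm2 : AEStronglyMeasurable (fun x => M * g i x) μ := (hgm i).const_mul M
  calc eLpNorm (fun x => f x * g i x) 2 μ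
      ≤ eLpNorm ((fun x => ‖C * A.indicator f x‖) + fun x => ‖M * g i x‖) 2 μ :=
        eLpNorm_mono_real hpt
    _ ≤ eLpNorm (fun x => ‖C * A.indicator f x‖) 2 μ + eLpNorm (fun x => ‖M * g i x‖) 2 μ :=
        eLpNorm_add_le hm1.norm hm2.norm one_le_two
    _ = ‖C‖ₑ * eLpNorm (A.indicator f) 2 μ + ‖M‖ₑ * eLpNorm (g i) 2 μ := by
        rw [eLpNorm_norm, eLpNorm_norm]
        congr 1
        exacts [eLpNorm_const_smul C _ _ _, eLpNorm_const_smul M _ _ _]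
    _ ≤ ‖C‖ₑ * η + η := by gcongr
    _ = η * (‖C‖ₑ + 1) := by ring
    _ ≤ ε := hηε.le

namespace LQGGame

variable {d : ℕ} {μθ σθ : ℝ} (G : LQGGame.{u} d μθ σθ)

/-- The neighbourhood filter of a game for the distance `gameDist`. -/
noncomputable def nhdsFilter : Filter (LQGGame.{u} d μθ σθ) := comap (gameDist G) (𝓝 0)

theorem tendsto_gameDist : Tendsto (gameDist G) G.nhdsFilter (𝓝 0) := tendsto_comap

theorem tendsto_of_le_gameDist {f : LQGGame.{u} d μθ σθ → ℝ≥0∞} (h : ∀ G', f G' ≤ gameDist G G') :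
    Tendsto f G.nhdsFilter (𝓝 0) :=
  tendsto_of_tendsto_of_tendsto_of_le_of_le tendsto_const_nhds G.tendsto_gameDist
    (fun _ => zero_le) h

theorem eLpNorm_b_sub_le (G' : LQGGame.{u} d μθ σθ) :
    eLpNorm (fun i => G.b i - G'.b i) 2 volume ≤ gameDist G G' := by
  unfold gameDist
  exact le_add_right (le_add_right (le_add_right le_self_add))

theorem eLpNorm_c_sub_le (G' : LQGGame.{u} d μθ σθ) :
    eLpNorm (fun i => G.c i - G'.c i) 2 volume ≤ gameDist G G' := by
  unfold gameDist
  exact le_add_right (le_add_right (le_add_right le_add_self))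

theorem weightDist_le (G' : LQGGame.{u} d μθ σθ) : weightDist G.w G'.w ≤ gameDist G G' := by
  unfold gameDist
  exact le_add_right (le_add_right le_add_self)

theorem eLpNorm_P_sub_le (G' : LQGGame.{u} d μθ σθ) :
    eLpNorm (fun p : unitInterval × unitInterval => ‖Matrix.toEuclideanCLM (𝕜 := ℝ)
      (G.info.P p.1 p.2 - G'.info.P p.1 p.2)‖) 2 volume ≤ gameDist G G' := by
  rw [eLpNorm_norm]
  unfold gameDist
  exact le_add_right le_add_self

theorem eLpNorm_Pθ_sub_le (G' : LQGGame.{u} d μθ σθ) :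
    eLpNorm (fun i => ‖(WithLp.toLp 2 (G.info.Pθ i - G'.info.Pθ i) :
      EuclideanSpace ℝ (Fin d))‖) 2 volume ≤ gameDist G G' := by
  rw [eLpNorm_norm]
  unfold gameDist
  exact le_add_self

theorem tendsto_bestResponseOp : Tendsto (fun G' : LQGGame.{u} d μθ σθ => G'.bestResponseOp)
    G.nhdsFilter (𝓝 G.bestResponseOp) := by
  set g : LQGGame.{u} d μθ σθ → unitInterval × unitInterval → ℝ := fun G' p =>
    ‖Matrix.toEuclideanCLM (𝕜 := ℝ) (G.info.P p.1 p.2 - G'.info.P p.1 p.2)‖ with hg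
  have hgm : ∀ G', StronglyMeasurable (g G') := fun G' =>
    (Matrix.stronglyMeasurable_toEuclideanCLM fun k l =>
      (G.info.measurable_P k l).sub (G'.info.measurable_P k l)).norm
  have hgb : ∀ G' p, ‖g G' p‖ ≤ 2 := fun G' p => by
    rw [hg, norm_norm, map_sub]
    refine (norm_sub_le _ _).trans ?_
    linarith [G.info.norm_toEuclideanCLM_P_le p.1 p.2, G'.info.norm_toEuclideanCLM_P_le p.1 p.2]
  have hP : Tendsto (fun G' => eLpNorm (g G') 2 volume) G.nhdsFilter (𝓝 0) :=
    G.tendsto_of_le_gameDist G.eLpNorm_P_sub_le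
  have hw : Tendsto (fun G' => weightDist G.w G'.w) G.nhdsFilter (𝓝 0) :=
    G.tendsto_of_le_gameDist G.weightDist_le
  have hwg := tendsto_eLpNorm_mul_of_bounded G.memLp_w G.measurable_w.stronglyMeasurable
    (fun G' => (hgm G').aestronglyMeasurable) hgb hP
  have hlim := hw.add hwg
  rw [add_zero] at hlim
  have hlim' := (ENNReal.tendsto_toReal ENNReal.zero_ne_top).comp hlim
  have hfin : ∀ᶠ G' in G.nhdsFilter, weightDist G.w G'.w +
      eLpNorm (fun p => Function.uncurry G.w p * g G' p) 2 volume < ∞ :=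
    hlim.eventually_lt_const ENNReal.zero_lt_top
  rw [tendsto_iff_norm_sub_tendsto_zero]
  refine squeeze_zero' (Eventually.of_forall fun _ => norm_nonneg _) ?_ hlim'
  filter_upwards [hfin] with G' hG'
  rw [norm_sub_rev]
  refine (norm_kernelOp_sub_le G.memLp_kernel G'.memLp_kernel).trans ?_
  refine ENNReal.toReal_mono hG'.ne ?_
  have hpt : ∀ p, ‖(G.kernel - G'.kernel) p‖ ≤
      ‖G.w p.1 p.2 - G'.w p.1 p.2‖ + ‖Function.uncurry G.w p * g G' p‖ := fun p => by
    have h : (G.kernel - G'.kernel) p = (G.w p.1 p.2 - G'.w p.1 p.2) • G'.info.condOp p.1 p.2 +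
        G.w p.1 p.2 • (G.info.condOp p.1 p.2 - G'.info.condOp p.1 p.2) := by
      simp only [Pi.sub_apply, kernel]
      module
    rw [h]
    refine (norm_add_le _ _).trans (add_le_add ?_ ?_)
    · rw [norm_smul]
      exact mul_le_of_le_one_right (norm_nonneg _) (G'.info.norm_condOp_le _ _)
    · rw [norm_smul, norm_mul, hg, norm_norm]
      exact mul_le_mul_of_nonneg_left (norm_toEuclideanCLM_withIntercept_sub_le _ _)
        (norm_nonneg _)
  have hm1 : AEStronglyMeasurable (fun p : unitInterval × unitInterval =>
      G.w p.1 p.2 - G'.w p.1 p.2) volume :=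
    (G.measurable_w.sub G'.measurable_w).aestronglyMeasurable
  have hm2 : AEStronglyMeasurable (fun p => Function.uncurry G.w p * g G' p) volume :=
    (G.measurable_w.mul (hgm G').measurable).aestronglyMeasurable
  refine (eLpNorm_mono_real hpt).trans ((eLpNorm_add_le hm1.norm hm2.norm one_le_two).trans_eq ?_)
  rw [eLpNorm_norm, eLpNorm_norm]
  rfl

theorem norm_stateCoeff_sub (Q Q' : SignalProcess.{u} d μθ σθ) (hσ : 0 < σθ) (i : unitInterval) :
    ‖Q.stateCoeff i - Q'.stateCoeff i‖ =
      σθ * ‖(WithLp.toLp 2 (Q.Pθ i - Q'.Pθ i) : EuclideanSpace ℝ (Fin d))‖ := by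
  rw [← sq_eq_sq₀ (norm_nonneg _) (mul_nonneg hσ.le (norm_nonneg _)), mul_pow,
    EuclideanSpace.norm_sq_eq, EuclideanSpace.norm_sq_eq, Fin.sum_univ_succ, Finset.mul_sum]
  simp [SignalProcess.stateCoeff, ← mul_sub, mul_pow]

theorem norm_drift_sub_le (hσ : 0 < σθ) (G' : LQGGame.{u} d μθ σθ) (i : unitInterval) :
    ‖(G.drift - G'.drift) i‖ ≤ ‖(|μθ| + σθ) * (G.b i - G'.b i)‖ +
      ‖σθ * (G.b i * ‖(WithLp.toLp 2 (G.info.Pθ i - G'.info.Pθ i) :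
        EuclideanSpace ℝ (Fin d))‖)‖ + ‖G.c i - G'.c i‖ := by
  have h : (G.drift - G'.drift) i = (G.b i - G'.b i) • G'.info.stateCoeff i +
      G.b i • (G.info.stateCoeff i - G'.info.stateCoeff i) +
      (EuclideanSpace.single 0 (G.c i) - EuclideanSpace.single 0 (G'.c i)) := by
    simp only [Pi.sub_apply, drift]
    module
  rw [h]
  refine (norm_add₃_le).trans (add_le_add_three ?_ ?_ ?_)
  · rw [norm_smul, norm_mul, mul_comm]
    gcongr
    exact (norm_stateCoeff_le _ hσ i).trans (Real.le_norm_self _)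
  · rw [norm_smul, norm_stateCoeff_sub _ _ hσ, norm_mul, norm_mul, norm_norm,
      Real.norm_of_nonneg hσ.le]
    exact (mul_left_comm _ _ _).le
  · have h2 : (EuclideanSpace.single 0 (G.c i) - EuclideanSpace.single 0 (G'.c i) :
        EuclideanSpace ℝ (Fin (d + 1))) = EuclideanSpace.single 0 (G.c i - G'.c i) := by
      ext k
      cases k using Fin.cases <;> simp
    rw [h2, PiLp.norm_single]

theorem measurable_norm_Pθ_sub (Q Q' : InfoStructure.{u} d μθ σθ) :
    Measurable fun i => ‖(WithLp.toLp 2 (Q.Pθ i - Q'.Pθ i) : EuclideanSpace ℝ (Fin d))‖ := by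
  have h : Measurable fun i => Q.Pθ i - Q'.Pθ i :=
    (measurable_pi_iff.2 Q.measurable_Pθ).sub (measurable_pi_iff.2 Q'.measurable_Pθ)
  exact ((PiLp.continuous_toLp 2 fun _ : Fin d => ℝ).measurable.comp h).norm

theorem tendsto_driftLp (hσ : 0 < σθ) : Tendsto (fun G' : LQGGame.{u} d μθ σθ => G'.driftLp hσ)
    G.nhdsFilter (𝓝 (G.driftLp hσ)) := by
  set g : LQGGame.{u} d μθ σθ → unitInterval → ℝ := fun G' i =>
    ‖(WithLp.toLp 2 (G.info.Pθ i - G'.info.Pθ i) : EuclideanSpace ℝ (Fin d))‖ with hg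
  have hgm : ∀ G', Measurable (g G') := fun G' => measurable_norm_Pθ_sub G.info G'.info
  have hgb : ∀ G' i, ‖g G' i‖ ≤ 2 := fun G' i => by
    rw [hg, norm_norm, WithLp.toLp_sub]
    refine (norm_sub_le _ _).trans ?_
    linarith [G.info.norm_Pθ_le hσ i, G'.info.norm_Pθ_le hσ i]
  have hP : Tendsto (fun G' => eLpNorm (g G') 2 volume) G.nhdsFilter (𝓝 0) :=
    G.tendsto_of_le_gameDist G.eLpNorm_Pθ_sub_le
  have hb : Tendsto (fun G' : LQGGame.{u} d μθ σθ => eLpNorm (fun i => G.b i - G'.b i) 2 volume)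
      G.nhdsFilter (𝓝 0) := G.tendsto_of_le_gameDist G.eLpNorm_b_sub_le
  have hc : Tendsto (fun G' : LQGGame.{u} d μθ σθ => eLpNorm (fun i => G.c i - G'.c i) 2 volume)
      G.nhdsFilter (𝓝 0) := G.tendsto_of_le_gameDist G.eLpNorm_c_sub_le
  have hbg := tendsto_eLpNorm_mul_of_bounded G.memLp_b G.measurable_b.stronglyMeasurable
    (fun G' => (hgm G').aestronglyMeasurable) hgb hP
  have hlim := ((ENNReal.Tendsto.const_mul hb (Or.inr (enorm_ne_top (x := |μθ| + σθ)))).add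
    (ENNReal.Tendsto.const_mul hbg (Or.inr (enorm_ne_top (x := σθ))))).add hc
  simp only [mul_zero, add_zero] at hlim
  rw [tendsto_iff_edist_tendsto_0]
  refine tendsto_of_tendsto_of_tendsto_of_le_of_le tendsto_const_nhds hlim
    (fun _ => zero_le) fun G' => ?_
  rw [edist_comm, driftLp, driftLp, Lp.edist_toLp_toLp]
  have hpt : ∀ i, ‖(G.drift - G'.drift) i‖ ≤ ‖(|μθ| + σθ) * (G.b i - G'.b i)‖ +
      ‖σθ * (G.b i * g G' i)‖ + ‖G.c i - G'.c i‖ := fun i => G.norm_drift_sub_le hσ G' i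
  have hm1 : AEStronglyMeasurable (fun i => (|μθ| + σθ) * (G.b i - G'.b i)) volume :=
    ((G.measurable_b.sub G'.measurable_b).const_mul _).aestronglyMeasurable
  have hm2 : AEStronglyMeasurable (fun i => σθ * (G.b i * g G' i)) volume :=
    ((G.measurable_b.mul (hgm G')).const_mul σθ).aestronglyMeasurable
  have hm3 : AEStronglyMeasurable (fun i => G.c i - G'.c i) volume :=
    (G.measurable_c.sub G'.measurable_c).aestronglyMeasurable
  refine (eLpNorm_mono_real hpt).trans ((eLpNorm_add_le (hm1.norm.add hm2.norm) hm3.norm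
    one_le_two).trans ?_)
  refine (add_le_add_left (eLpNorm_add_le hm1.norm hm2.norm one_le_two) _).trans_eq ?_
  have h1 : eLpNorm (fun i => (|μθ| + σθ) * (G.b i - G'.b i)) 2 volume =
      ‖|μθ| + σθ‖ₑ * eLpNorm (fun i => G.b i - G'.b i) 2 volume :=
    eLpNorm_const_smul (|μθ| + σθ) (fun i => G.b i - G'.b i) 2 volume
  have h2 : eLpNorm (fun i => σθ * (G.b i * g G' i)) 2 volume =
      ‖σθ‖ₑ * eLpNorm (fun i => G.b i * g G' i) 2 volume :=
    eLpNorm_const_smul σθ (fun i => G.b i * g G' i) 2 volume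
  rw [eLpNorm_norm, eLpNorm_norm, eLpNorm_norm, h1, h2]

variable {G}

theorem HasUniqueAffineEquilibrium.eventually (hσ : 0 < σθ) (h : G.HasUniqueAffineEquilibrium) :
    ∀ᶠ G' in G.nhdsFilter, G'.HasUniqueAffineEquilibrium := by
  simp only [hasUniqueAffineEquilibrium_iff hσ] at h ⊢
  exact (tendsto_const_nhds.sub G.tendsto_bestResponseOp).eventually
    (Units.isOpen.mem_nhds h)

theorem gameDist_eq_weightDist {G G' : LQGGame.{u} d μθ σθ} (hb : G'.b = G.b) (hc : G'.c = G.c)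
    (hinfo : G'.info = G.info) : gameDist G G' = weightDist G.w G'.w := by
  have hP : eLpNorm (fun p : unitInterval × unitInterval => Matrix.toEuclideanCLM (𝕜 := ℝ)
      (G.info.P p.1 p.2 - G'.info.P p.1 p.2)) 2 volume = 0 := by
    rw [← eLpNorm_norm, hinfo]
    simp only [sub_self, map_zero, norm_zero]
    exact eLpNorm_zero'
  have hPθ : eLpNorm (fun i => WithLp.toLp 2 (G.info.Pθ i - G'.info.Pθ i)) 2 volume = 0 := by
    rw [hinfo]
    simp only [sub_self, WithLp.toLp_zero]
    exact eLpNorm_zero'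
  unfold gameDist
  rw [hP, hPθ, hb, hc]
  simp

/-- Replacing `w` by `t w` replaces the best-response operator `T` by `t T`, and `1 - t T` is
invertible for some `t` arbitrarily close to `1`. -/
theorem exists_isUnique_smul_weight (hσ : 0 < σθ) (G : LQGGame.{u} d μθ σθ) {ε : ℝ≥0∞}
    (hε : 0 < ε) :
    ∃ G' : LQGGame.{u} d μθ σθ, G'.U = G.U ∧ G'.b = G.b ∧ G'.c = G.c ∧ G'.info = G.info ∧
      weightDist G.w G'.w < ε ∧ gameDist G G' < ε ∧ G'.HasUniqueAffineEquilibrium := by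
  obtain ⟨η, hη, hηε⟩ := ENNReal.exists_nnreal_pos_mul_lt G.memLp_w.2.ne hε.ne'
  obtain ⟨t, ht1, htη, hu⟩ := G.isCompactOperator_bestResponseOp.exists_isUnit_one_sub_smul
    (ε := η) (by exact_mod_cast hη)
  let G' : LQGGame.{u} d μθ σθ :=
    { G with
      w := fun i j => t * G.w i j
      measurable_w := G.measurable_w.const_mul t
      memLp_w := G.memLp_w.const_mul t }
  have hT : G'.bestResponseOp = t • G.bestResponseOp := by
    rw [bestResponseOp, bestResponseOp, ← kernelOp_const_smul]
    congr 1
    ext1 p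
    exact mul_smul t (G.w p.1 p.2) (G.info.condOp p.1 p.2)
  have hwd : weightDist G.w G'.w < ε := by
    have h : (fun p : unitInterval × unitInterval => G.w p.1 p.2 - G'.w p.1 p.2) =
        (1 - t) • Function.uncurry G.w := by
      ext p
      change G.w p.1 p.2 - t * G.w p.1 p.2 = (1 - t) * G.w p.1 p.2
      ring
    rw [weightDist, h, eLpNorm_const_smul]
    refine lt_of_le_of_lt ?_ hηε
    gcongr
    rw [enorm_sub_rev, Real.enorm_of_nonneg (by linarith)]
    exact (ENNReal.ofReal_le_ofReal (by linarith)).trans_eq ENNReal.ofReal_coe_nnreal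
  refine ⟨G', rfl, rfl, rfl, rfl, hwd, ?_,
    (hasUniqueAffineEquilibrium_iff hσ).2 (hT ▸ hu)⟩
  exact (gameDist_eq_weightDist (G := G) (G' := G') rfl rfl rfl).trans_lt hwd

end LQGGame

/-! ### Denseness, openness and convergence -/

theorem theorem1 (d : ℕ) (μθ σθ : ℝ) (hσ : 0 < σθ) :
    -- denseness: it suffices to perturb `w`
    (∀ (G : LQGGame.{u} d μθ σθ) (ε : ℝ≥0∞), 0 < ε →
      ∃ G' : LQGGame.{u} d μθ σθ, G'.U = G.U ∧ G'.b = G.b ∧ G'.c = G.c ∧ G'.info = G.info ∧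
        LQGGame.weightDist G.w G'.w < ε ∧ LQGGame.gameDist G G' < ε ∧
        G'.HasUniqueAffineEquilibrium) ∧
    -- openness
    (∀ G : LQGGame.{u} d μθ σθ, G.HasUniqueAffineEquilibrium →
      ∃ δ : ℝ≥0∞, 0 < δ ∧ ∀ G' : LQGGame.{u} d μθ σθ,
        LQGGame.gameDist G G' < δ → G'.HasUniqueAffineEquilibrium) ∧
    -- convergence
    (∀ (G : LQGGame.{u} d μθ σθ) (φ : unitInterval → EuclideanSpace ℝ (Fin (d + 1))),
      G.IsUniqueAffineEquilibrium φ →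
      ∀ Gs : ℕ → LQGGame.{u} d μθ σθ,
        Tendsto (fun n => LQGGame.gameDist G (Gs n)) atTop (𝓝 0) →
        (∀ᶠ n in atTop, (Gs n).HasUniqueAffineEquilibrium) ∧
        ∀ φs : ℕ → unitInterval → EuclideanSpace ℝ (Fin (d + 1)),
          (∀ᶠ n in atTop, (Gs n).IsUniqueAffineEquilibrium (φs n)) →
          Tendsto (fun n => eLpNorm (φ - φs n) 2 volume) atTop (𝓝 0)) := by
  refine ⟨fun G ε hε => G.exists_isUnique_smul_weight hσ hε, fun G hG => ?_,
    fun G φ hφ Gs hGs => ?_⟩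
  · obtain ⟨V, hV, hVG⟩ := mem_comap.1 (hG.eventually hσ)
    obtain ⟨δ, hδ, hδV⟩ := ENNReal.nhds_zero_basis.mem_iff.1 hV
    exact ⟨δ, hδ, fun G' hG' => hVG (hδV hG')⟩
  · have hlim : Tendsto Gs atTop G.nhdsFilter := tendsto_comap_iff.2 hGs
    have hex : G.HasUniqueAffineEquilibrium := ⟨φ, hφ⟩
    refine ⟨hlim.eventually (hex.eventually hσ), fun φs hφs => ?_⟩
    obtain ⟨a, ha⟩ := hex.isUnit hσ
    have hinv : Tendsto (fun n => Ring.inverse (1 - (Gs n).bestResponseOp)) atTop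
        (𝓝 (Ring.inverse (1 - G.bestResponseOp))) := by
      have hcont := NormedRing.inverse_continuousAt a
      rw [ha] at hcont
      exact hcont.tendsto.comp (tendsto_const_nhds.sub (G.tendsto_bestResponseOp.comp hlim))
    have hsol := (isBoundedBilinearMap_apply.continuous.tendsto (_, _)).comp
      (hinv.prodMk_nhds ((G.tendsto_driftLp hσ).comp hlim))
    simp only [Function.comp_def] at hsol
    rw [← hφ.toLp_eq hσ, tendsto_iff_edist_tendsto_0] at hsol
    refine hsol.congr' ?_
    filter_upwards [hφs] with n hn
    rw [← hn.toLp_eq hσ, edist_comm, Lp.edist_toLp_toLp]
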